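/- \textbf{Setting.} Advertisers $a\in A$ have budgets $B_a>0$; impressions $0,1,2,\dots$ arrive in this order, and $a$ bids $b_{ai}\in[0,B_a]$ for impression $i$. An oblivious semi-randomized algorithm fixes, independently of the random bits below, for every impression either a deterministic round (the impression is assigned to one advertiser) or a randomized round (it is semi-assigned to two distinct advertisers). The subsets are chosen by the panoramic interval-level assignment: for each $a$, view $[0,B_a)$ as a circle, and keep a point $y^*$ (initially $0$) and the set $Y_D$ of points assigned deterministically so far. When $i$ is assigned or semi-assigned to $a$, scan forward from $y^*$ until measure $b_{ai}$ outside $Y_D$ has been met (once around the circle if less than $b_{ai}$ is available outside $Y_D$); $Y_{ai}$ is the scanned arc minus $Y_D$, and $y^*$ moves to the end of the arc. Fix one of the two conventions: a bid $b_{ai}$ is \emph{large} if $b_{ai}>B_a/2$, or it is large if $b_{ai}\ge B_a/2$; other bids are \emph{small}. The dependence graph $D$ on the randomized rounds has an arc $(i',i)_a$, $i'<i$, if both are semi-assigned to $a$ with large bids and some $y\in Y_{ai'}\cap Y_{ai}$ lies in no $Y_{aj}$ with $i'<j<i$ and $j$ semi-assigned to $a$. \textbf{Algorithm} (sender probability $p\in[0,1]$).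 When an impression $i$ of a randomized round arrives, semi-assigned to $a_1,a_2$: with probability $p$ it is a sender; it then selects $a_1$ or $a_2$ with a fresh fair bit, and independently picks uniformly one of four (possibly non-existent) arcs of $D$, the first or the second out-arc of $i$ with respect to $a_1$ or $a_2$. With probability $1-p$ it is a receiver; if some in-arcs of $i$ in $D$ have been picked by senders, it chooses one of them, $(i',i)_a$, uniformly at random, and selects $a$ if $i'$ did not select $a$, and the other one of $a_1,a_2$ if $i'$ selected $a$; if there is no such in-arc, it selects with a fresh fair bit. Consider any number of first impressions. For $y\in[0,B_a)$, let $k_a(y)$ be the number of these impressions that are semi-assigned to $a$ with $y\in Y_{ai}$, and $k_a(y)=\infty$ if one of them is assigned to $a$ in a deterministic round with $y\in Y_{ai}$. Let $k_a^L(y)$ be the number of large-bid impressions among these semi-assignments of $y$ before the first one with a small bid, and $k_a^L(y)=k_a(y)$ if none of them has a small bid. The point $y$ of $a$ is \emph{assigned} if some impression that selected $a$, or that was deterministically assigned to $a$, has $y\in Y_{ai}$. \textbf{Lemma.} Let $\gamma=\frac14\,p(1-p)\bigl(1-\frac{3p}{8}\bigr)$. For arbitrary bids, every advertiser $a$ and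 every $y\in[0,B_a)$, the point $y$ of $a$ is assigned with probability at least $$1-2^{-k_a(y)}(1-\gamma)^{\max\{k_a^L(y)-1,\,0\}}$$ (which is $1$ if $k_a(y)=\infty$). In particular, if all nonzero bids are large, the algorithm is a $\gamma$-PanOCS: $0\le\gamma\le1$, and every point $y$ of every $a$ is assigned with probability at least $1-2^{-k_a(y)}(1-\gamma)^{\max\{k_a(y)-1,0\}}$. -/

import Mathlib

open Set MeasureTheory

noncomputable section

namespace PanOCS

/-- The decision of an oblivious semi-randomized algorithm for one impression: either a deterministic
round, which assigns the impression to one advertiser, or a randomized round, which semi-assigns it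
to two distinct advertisers. -/
inductive Round (A : Type*) where
  | det (a : A) : Round A
  | rand (a₁ a₂ : A) (ne : a₁ ≠ a₂) : Round A

/-- The impression is semi-assigned to `a` (randomized rounds only). -/
def Round.SemiAssigns {A : Type*} : Round A → A → Prop
  | .det _, _ => False
  | .rand a₁ a₂ _, a => a = a₁ ∨ a = a₂

/-- The impression is assigned to `a` in a deterministic round. -/
def Round.DetAssigns {A : Type*} : Round A → A → Prop
  | .det a', a => a = a'
  | .rand _ _ _, _ => False

/-- An AdWords instance with set of advertisers `A` whose impressions `0, 1, 2, …` arrive in this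
order, together with the choices of an oblivious semi-randomized algorithm, which are fixed
independently of all random bits of the selection procedure. -/
structure Input (A : Type*) where
  budget : A → ℝ
  bid : A → ℕ → ℝ
  round : ℕ → Round A
  budget_pos : ∀ a, 0 < budget a
  bid_nonneg : ∀ a i, 0 ≤ bid a i
  bid_le : ∀ a i, bid a i ≤ budget a

/-! ### Panoramic interval-level assignment -/

/-- The arc of length `l` starting at `y`, in the direction of increasing coordinates, on the circle
obtained from `[0, B)` by gluing its endpoints. For `0 ≤ y < B` and `l = B` it is all of `[0, B)`. -/
def circArc (B y l : ℝ) : Set ℝ :=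
  {x | 0 ≤ x ∧ x < B ∧ ((y ≤ x ∧ x < y + l) ∨ (x < y ∧ x + B < y + l))}

open Classical in
/-- The length that has to be scanned from `y` until a measure `b` outside `Y` has been met; the
full circle if less than `b` is available. -/
def scanLength (B y b : ℝ) (Y : Set ℝ) : ℝ :=
  if b ≤ volume.real (Ico 0 B \ Y) then
    sInf {l | 0 ≤ l ∧ l ≤ B ∧ b ≤ volume.real (circArc B y l \ Y)}
  else B

open Classical in
/-- The point `y ⊕_Y b` of `[0, B)`, the end of the scanned arc. -/
def oplus (B y b : ℝ) (Y : Set ℝ) : ℝ :=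
  if y + scanLength B y b Y < B then y + scanLength B y b Y
  else y + scanLength B y b Y - B

/-- The subset `[y, y ⊕_Y b) \ Y`. -/
def scanSet (B y b : ℝ) (Y : Set ℝ) : Set ℝ :=
  circArc B y (scanLength B y b Y) \ Y

namespace Input

variable {A : Type*} (I : Input A)

open Classical in
/-- The state of the interval-level assignment of `a` before impression `t`: the starting point `y*`
of the next subset, and the set `Y_D` of points that have been assigned deterministically. -/
def scanState (a : A) : ℕ → ℝ × Set ℝ
  | 0 => (0, ∅)
  | t + 1 =>
    let s := scanState a t
    let y' := oplus (I.budget a) s.1 (I.bid a t) s.2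
    if (I.round t).DetAssigns a then
      (y', s.2 ∪ scanSet (I.budget a) s.1 (I.bid a t) s.2)
    else if (I.round t).SemiAssigns a then (y', s.2)
    else s

/-- The subset `Y_{at}` of `[0, B_a)` to which impression `t` is (semi-)assigned if it is
(semi-)assigned to `a`. -/
def subset (a : A) (t : ℕ) : Set ℝ :=
  scanSet (I.budget a) (I.scanState a t).1 (I.bid a t) (I.scanState a t).2

/-- Impression `t` is semi-assigned to `a` and a subset containing `y`. -/
def SemiAssigned (a : A) (y : ℝ) (t : ℕ) : Prop :=
  (I.round t).SemiAssigns a ∧ y ∈ I.subset a t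

/-- Impression `t` is assigned to `a` and a subset containing `y` in a deterministic round. -/
def DetAssigned (a : A) (y : ℝ) (t : ℕ) : Prop :=
  (I.round t).DetAssigns a ∧ y ∈ I.subset a t

/-- The bid of `a` for `t` is large. Bids equal to half of the budget count as large if and only if
`incl = true`. -/
def Large (incl : Bool) (a : A) (t : ℕ) : Prop :=
  I.budget a / 2 < I.bid a t ∨ (incl = true ∧ I.bid a t = I.budget a / 2)

open Classical in
/-- `k_a(y)` after the first `T` impressions: the number of semi-assignments of `y`, or `∞` if `y`
has been assigned in a deterministic round. -/
def semiCount (T : ℕ) (a : A) (y : ℝ) : ℕ∞ :=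
  if ∃ t < T, I.DetAssigned a y t then ⊤
  else (((Finset.range T).filter fun t => I.SemiAssigned a y t).card : ℕ∞)

open Classical in
/-- `k_a^L(y)` after the first `T` impressions: the number of semi-assignments of `y` by large bids
before the first semi-assignment of `y` by a small bid; equal to `k_a(y)` if `y` has never been
semi-assigned by a small bid. -/
def largeCount (incl : Bool) (T : ℕ) (a : A) (y : ℝ) : ℕ∞ :=
  if ∃ t < T, I.SemiAssigned a y t ∧ ¬ I.Large incl a t then
    (((Finset.range T).filter fun t => I.SemiAssigned a y t ∧ I.Large incl a t ∧
      ∀ s < t, I.SemiAssigned a y s → I.Large incl a s).card : ℕ∞)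
  else I.semiCount T a y

/-! ### The correlated selection -/

/-- `i < i'` are adjacent with respect to `a`: some `y` belongs to the subsets of both, and to no
subset of an impression semi-assigned to `a` in between. -/
def Adjacent (a : A) (i i' : ℕ) : Prop :=
  i < i' ∧ ∃ y, I.SemiAssigned a y i ∧ I.SemiAssigned a y i' ∧
    ∀ j, i < j → j < i' → ¬ I.SemiAssigned a y j

/-- The arc `(i, i')_a` belongs to the ex-ante dependence graph `D`. -/
def Arc (incl : Bool) (a : A) (i i' : ℕ) : Prop :=
  I.Adjacent a i i' ∧ I.Large incl a i ∧ I.Large incl a i'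

open Classical in
/-- The position (starting from `0`, in order of arrival) of the arc `(i, i')_a` among the out-arcs
of `i` with respect to `a`. -/
def arcIndex (incl : Bool) (a : A) (i i' : ℕ) : ℕ :=
  ((Finset.range i').filter fun j => I.Arc incl a i j).card

end Input

/-- What happens in one round. -/
structure Decision (A : Type*) where
  /-- `some (a, j)` for a sender that picks its `j`-th out-arc (`j = 0, 1`) with respect to `a`;
  `none` for a receiver and in a deterministic round. -/
  pick : Option (A × Fin 2)
  /-- The in-arc `(i', i)_a`, written `(i', a)`, that is added to the ex-post graph, if any. -/
  matched : Option (ℕ × A)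
  /-- The selected advertiser. -/
  choice : A

/-- The decisions made so far. -/
abbrev History (A : Type*) := ℕ → Option (Decision A)

/-- In the history `H`, impression `i` has selected `a`. -/
def History.Selected {A : Type*} (H : History A) (i : ℕ) (a : A) : Prop :=
  ∃ d, H i = some d ∧ d.choice = a

/-- A coin that shows `true` with probability `p`. -/
def coin (p : ℝ) (hp : p ∈ Icc (0 : ℝ) 1) : PMF Bool :=
  PMF.ofFintype (fun b => cond b (ENNReal.ofReal p) (ENNReal.ofReal (1 - p))) (by
    rw [Fintype.sum_bool, cond_true, cond_false, ← ENNReal.ofReal_add hp.1 (by linarith [hp.2])]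
    simp)

namespace Input

variable {A : Type*} (I : Input A)

/-- In the history `H`, impression `i` is a sender that picks the arc `(i, i')_a` of `D`. -/
def Picks (incl : Bool) (H : History A) (a : A) (i i' : ℕ) : Prop :=
  I.Arc incl a i i' ∧
    ∃ d j, H i = some d ∧ d.pick = some (a, j) ∧ (j : ℕ) = I.arcIndex incl a i i'

open Classical in
/-- The in-arcs `(i, t)_a` of `t` in `D`, written `(i, a)`, that are picked by a sender `i`, where
`t` is semi-assigned to `a₁` and `a₂`. -/
def pickedInArcs (incl : Bool) (H : History A) (t : ℕ) (a₁ a₂ : A) : Finset (ℕ × A) :=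
  (Finset.range t ×ˢ {a₁, a₂}).filter fun e => I.Picks incl H e.2 e.1 t

open Classical in
/-- The random decision for impression `t`, given the earlier decisions `H`. -/
def decide (incl : Bool) (p : ℝ) (hp : p ∈ Icc (0 : ℝ) 1) (H : History A) (t : ℕ) :
    PMF (Decision A) :=
  match I.round t with
  | .det a => PMF.pure ⟨none, none, a⟩
  | .rand a₁ a₂ _ =>
    (coin p hp).bind fun sender =>
      if sender = true then
        (PMF.uniformOfFintype Bool).bind fun c =>
          (PMF.uniformOfFintype (Bool × Fin 2)).map fun e =>
            ⟨some (if e.1 = true then a₁ else a₂, e.2), none, if c = true then a₁ else a₂⟩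
      else if h : (I.pickedInArcs incl H t a₁ a₂).Nonempty then
        (PMF.uniformOfFinset (I.pickedInArcs incl H t a₁ a₂) h).map fun e =>
          ⟨none, some e,
            if H.Selected e.1 e.2 then (if e.2 = a₁ then a₂ else a₁) else e.2⟩
      else
        (PMF.uniformOfFintype Bool).map fun c =>
          ⟨none, none, if c = true then a₁ else a₂⟩

/-- The joint law of the decisions for the first `T` impressions. -/
def law (incl : Bool) (p : ℝ) (hp : p ∈ Icc (0 : ℝ) 1) : ℕ → PMF (History A)
  | 0 => PMF.pure fun _ => none
  | T + 1 =>
    (law incl p hp T).bind fun H =>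
      (I.decide incl p hp H T).map fun d => Function.update H T (some d)

/-- `x_a(y)` after the first `T` impressions: the probability that some impression assigned to `a`
is assigned to a subset containing `y`. -/
def assignProb (incl : Bool) (p : ℝ) (hp : p ∈ Icc (0 : ℝ) 1) (T : ℕ) (a : A) (y : ℝ) : ℝ :=
  ((I.law incl p hp T).toOuterMeasure
    {H | ∃ t < T, H.Selected t a ∧ y ∈ I.subset a t}).toReal

end Input

/-- The constant `γ` for the sender probability `p`. -/
def gam (p : ℝ) : ℝ := p * (1 - p) * (1 - 3 * p / 8) / 4

open Classical in
/-- `1 - 2^{-k} (1 - γ)^{max(l - 1, 0)}`, which is `1` for `k = ∞`. -/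
def guarantee (γ : ℝ) (k l : ℕ∞) : ℝ :=
  if k = ⊤ then 1 else 1 - (1 / 2) ^ k.toNat * (1 - γ) ^ (l.toNat - 1)

end PanOCS

end

noncomputable section

namespace PanOCS

/-! ### Geometry of the scan -/

section Scan

variable {B y b l s : ℝ} {Y : Set ℝ}

/-! If `y` has been assigned deterministically, the probability is 1. Otherwise let `S` be the path
of `y`: the impressions semi-assigned to `a` with `y` in their subset. The point stays unassigned
exactly when every impression of `S` selects its other advertiser. This is impossible once a
receiver in `S` is matched to a sender in `S`: exactly one of the two selects the advertiser
labelling the arc, hence exactly one selects `a` (`conflicting_path`).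

The exact formula is `lexp_picks_mul_sel`: the probability of the event is `2^{-|S|}` times the
expectation, over picks that are independent across rounds, of the product of the weights of `S`.
The weight of `t` is the conditional probability, given the picks, that `t` is not matched along an
arc from `S`. The induction on time peels off the last impression. If it is matched to a source
outside `S`, the condition on its selection becomes a condition on the source, which is added to the
set. The source is a sender and its only picked arc is already used, so it contributes a factor 1/2
and changes no other weight.

It remains to bound the expected product of weights along the initial run `L` of large bids, whose
consecutive members are joined by arcs of `D`. Let `m`, `n` be consecutive, and let `V` be the
product of the weights before `m`. With probability `p/4` the sender `m` picks the arc to `n`, with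
probability `1 - p` the impression `n` is a receiver, and then `n` is matched inside `S` with
probability at least `1 / (1 + N)`, where `N` counts the picked in-arcs of `n` from outside `S`. At
most three such arcs exist, and picking one of them can only lower `V`, because its source no longer
competes at an earlier impression. Hence `E[V N] ≤ (3p/4) E[V]`, and `1 / (1 + N) ≥ 1 - N / 2`
yields the factor `1 - gam p` (`pexp_mul_weight_le`).

The degree bounds in `D` are geometric: between adjacent impressions the scan covers less than the
full circle, so at most one large bid fits in between (`Adjacent.not_two_large`). -/

theorem volume_real_circArc_diff_le (hl : 0 ≤ l) (hy : y ∈ Ico 0 B) :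
    volume.real (circArc B y l \ Y) ≤ l := by
  have hsub : circArc B y l \ Y ⊆ Ico y (min B (y + l)) ∪ Ico 0 (y + l - B) := by
    rintro x ⟨⟨h0, hB, h | h⟩, -⟩
    · exact Or.inl ⟨h.1, lt_min hB h.2⟩
    · exact Or.inr ⟨h0, by linarith⟩
  have hfin : volume (Ico y (min B (y + l)) ∪ Ico 0 (y + l - B)) ≠ ⊤ :=
    (measure_union_lt_top (by simp) (by simp)).ne
  refine (measureReal_mono hsub hfin).trans ((measureReal_union_le _ _).trans ?_)
  rw [Real.volume_real_Ico, Real.volume_real_Ico]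
  have := hy.1
  have := hy.2
  rcases le_total B (y + l) with h | h
  · rw [min_eq_left h, max_eq_left, max_eq_left] <;> linarith
  · rw [min_eq_right h, max_eq_left, max_eq_right] <;> linarith

theorem circArc_full (hy : y ∈ Ico 0 B) : circArc B y B = Ico 0 B := by
  have := hy.1
  have := hy.2
  ext x
  constructor
  · exact fun h => ⟨h.1, h.2.1⟩
  · refine fun h => ⟨h.1, h.2, ?_⟩
    rcases le_or_gt y x with hx | hx
    · exact Or.inl ⟨hx, by linarith [h.2]⟩
    · exact Or.inr ⟨hx, by linarith⟩

theorem full_mem_scan (hy : y ∈ Ico 0 B) (h : b ≤ volume.real (Ico 0 B \ Y)) :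
    B ∈ {l | 0 ≤ l ∧ l ≤ B ∧ b ≤ volume.real (circArc B y l \ Y)} :=
  ⟨hy.1.trans hy.2.le, le_rfl, by rwa [circArc_full hy]⟩

theorem bddBelow_scan :
    BddBelow {l | 0 ≤ l ∧ l ≤ B ∧ b ≤ volume.real (circArc B y l \ Y)} :=
  ⟨0, fun _ h => h.1⟩

theorem scanLength_le (hy : y ∈ Ico 0 B) : scanLength B y b Y ≤ B := by
  unfold scanLength
  split_ifs with h
  · exact csInf_le bddBelow_scan (full_mem_scan hy h)
  · exact le_rfl

/-- An arc has measure at most its length, and removing `Y` only lengthens the scan. -/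
theorem le_scanLength (hy : y ∈ Ico 0 B) (hb : b ≤ B) : b ≤ scanLength B y b Y := by
  unfold scanLength
  split_ifs with h
  · exact le_csInf ⟨B, full_mem_scan hy h⟩ fun l hl =>
      hl.2.2.trans (volume_real_circArc_diff_le hl.1 hy)
  · exact hb

theorem scanLength_zero (hy : y ∈ Ico 0 B) : scanLength B y 0 Y = 0 := by
  refine le_antisymm ?_ (le_scanLength hy (hy.1.trans hy.2.le))
  rw [scanLength, if_pos measureReal_nonneg]
  exact csInf_le bddBelow_scan ⟨le_rfl, hy.1.trans hy.2.le, measureReal_nonneg⟩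

theorem scanSet_zero (hy : y ∈ Ico 0 B) : scanSet B y 0 Y = ∅ := by
  rw [scanSet, scanLength_zero hy, eq_empty_iff_forall_notMem]
  rintro x ⟨⟨h0, -, h | h⟩, -⟩
  · linarith [h.1, h.2]
  · linarith [h.2, hy.2]

theorem oplus_mem (hb : 0 ≤ b) (hbB : b ≤ B) (hy : y ∈ Ico 0 B) : oplus B y b Y ∈ Ico 0 B := by
  have h1 := scanLength_le (b := b) (Y := Y) hy
  have h2 := le_scanLength (Y := Y) hy hbB
  have := hy.1
  have := hy.2
  unfold oplus
  split_ifs with h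
  · exact ⟨by linarith, h⟩
  · exact ⟨by linarith, by linarith⟩

/-- The distance from `s` to `y` in the direction of increasing coordinates on the circle. -/
def fdist (B s y : ℝ) : ℝ := if s ≤ y then y - s else y - s + B

theorem fdist_nonneg (hs : s ∈ Ico 0 B) (hy : y ∈ Ico 0 B) : 0 ≤ fdist B s y := by
  unfold fdist
  split_ifs <;> linarith [hs.2, hy.1]

theorem fdist_lt (hs : s ∈ Ico 0 B) (hy : y ∈ Ico 0 B) : fdist B s y < B := by
  unfold fdist
  split_ifs <;> linarith [hs.1, hy.2]

theorem mem_circArc_iff (hy : y ∈ Ico 0 B) : y ∈ circArc B s l ↔ fdist B s y < l := by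
  unfold fdist circArc
  have := hy.1
  have := hy.2
  constructor
  · rintro ⟨-, -, h | h⟩
    · rw [if_pos h.1]; linarith
    · rw [if_neg (not_le.2 h.1)]; linarith
  · intro h
    refine ⟨hy.1, hy.2, ?_⟩
    split_ifs at h with hsy
    · exact Or.inl ⟨hsy, by linarith⟩
    · exact Or.inr ⟨not_le.1 hsy, by linarith⟩

/-- A scan that misses `y` moves towards `y` without passing it, so the forward distance drops by
exactly the scanned length, even across the glued endpoint. -/
theorem fdist_oplus (hb : 0 ≤ b) (hbB : b ≤ B) (hs : s ∈ Ico 0 B) (hy : y ∈ Ico 0 B)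
    (h : y ∉ circArc B s (scanLength B s b Y)) :
    fdist B (oplus B s b Y) y + scanLength B s b Y = fdist B s y := by
  rw [mem_circArc_iff hy, not_lt] at h
  have h0 := hb.trans (le_scanLength (Y := Y) hs hbB)
  have := hs.2
  have := hy.2
  unfold fdist oplus at *
  generalize scanLength B s b Y = l at *
  split_ifs at * <;> linarith

end Scan

/-! ### Evolution of the scan over the rounds -/

namespace Input

variable {A : Type*} (I : Input A) (incl : Bool) {a : A} {y : ℝ}

/-- Impression `t` is assigned or semi-assigned to `a`. -/
def Involves (a : A) (t : ℕ) : Prop :=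
  (I.round t).DetAssigns a ∨ (I.round t).SemiAssigns a

open Classical in
/-- The length of the arc scanned by `a` in round `t`. -/
def scanned (a : A) (t : ℕ) : ℝ :=
  if I.Involves a t then
    scanLength (I.budget a) (I.scanState a t).1 (I.bid a t) (I.scanState a t).2
  else 0

theorem scanState_succ_fst (a : A) (t : ℕ) (h : I.Involves a t) :
    (I.scanState a (t + 1)).1 =
      oplus (I.budget a) (I.scanState a t).1 (I.bid a t) (I.scanState a t).2 := by
  rw [scanState]
  rcases h with h | h
  · rw [if_pos h]
  · split_ifs <;> rfl

theorem scanState_succ_of_not (a : A) (t : ℕ) (h : ¬ I.Involves a t) :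
    I.scanState a (t + 1) = I.scanState a t := by
  rw [Involves, not_or] at h
  rw [scanState]
  rw [if_neg h.1, if_neg h.2]

theorem scanState_mem (a : A) (t : ℕ) : (I.scanState a t).1 ∈ Ico 0 (I.budget a) := by
  induction t with
  | zero => exact ⟨le_rfl, I.budget_pos a⟩
  | succ t ih =>
    by_cases h : I.Involves a t
    · rw [I.scanState_succ_fst a t h]
      exact oplus_mem (I.bid_nonneg a t) (I.bid_le a t) ih
    · rwa [I.scanState_succ_of_not a t h]

theorem scanState_snd_succ_subset (a : A) (t : ℕ) :
    (I.scanState a t).2 ⊆ (I.scanState a (t + 1)).2 := by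
  rw [scanState]
  split_ifs
  · exact subset_union_left
  · exact Subset.rfl
  · exact Subset.rfl

theorem scanState_snd_mono (a : A) : Monotone fun t => (I.scanState a t).2 :=
  monotone_nat_of_le_succ (I.scanState_snd_succ_subset a)

theorem subset_subset_of_detAssigns {t : ℕ} (h : (I.round t).DetAssigns a) :
    I.subset a t ⊆ (I.scanState a (t + 1)).2 := by
  rw [scanState]
  rw [if_pos h]
  exact subset_union_right

theorem mem_Ico_of_mem_subset {t : ℕ} (h : y ∈ I.subset a t) : y ∈ Ico 0 (I.budget a) :=
  ⟨h.1.1, h.1.2.1⟩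

theorem subset_eq_empty {t : ℕ} (h : I.bid a t = 0) : I.subset a t = ∅ := by
  rw [subset, h, scanSet_zero (I.scanState_mem a t)]

theorem bid_le_scanned {t : ℕ} (h : I.Involves a t) : I.bid a t ≤ I.scanned a t := by
  rw [scanned, if_pos h]
  exact le_scanLength (I.scanState_mem a t) (I.bid_le a t)

theorem scanned_nonneg (a : A) (t : ℕ) : 0 ≤ I.scanned a t := by
  by_cases h : I.Involves a t
  · exact (I.bid_nonneg a t).trans (I.bid_le_scanned h)
  · rw [scanned, if_neg h]

theorem fdist_scanState_succ (hy : y ∈ Ico 0 (I.budget a)) {t : ℕ}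
    (h : I.Involves a t → y ∉ circArc (I.budget a) (I.scanState a t).1 (I.scanned a t)) :
    fdist (I.budget a) (I.scanState a (t + 1)).1 y + I.scanned a t =
      fdist (I.budget a) (I.scanState a t).1 y := by
  by_cases ht : I.Involves a t
  · have h' := h ht
    rw [scanned, if_pos ht] at h' ⊢
    rw [I.scanState_succ_fst a t ht]
    exact fdist_oplus (I.bid_nonneg a t) (I.bid_le a t) (I.scanState_mem a t) hy h'
  · rw [I.scanState_succ_of_not a t ht, scanned, if_neg ht, add_zero]

theorem fdist_add_sum_scanned (hy : y ∈ Ico 0 (I.budget a)) {m n : ℕ} (hmn : m ≤ n)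
    (h : ∀ t, m ≤ t → t < n → I.Involves a t →
      y ∉ circArc (I.budget a) (I.scanState a t).1 (I.scanned a t)) :
    fdist (I.budget a) (I.scanState a n).1 y + ∑ t ∈ Finset.Ico m n, I.scanned a t =
      fdist (I.budget a) (I.scanState a m).1 y := by
  induction n, hmn using Nat.le_induction with
  | base => simp
  | succ n hmn ih =>
    rw [Finset.sum_Ico_succ_top hmn, ← ih fun t h1 h2 => h t h1 (h2.trans n.lt_succ_self),
      ← I.fdist_scanState_succ hy (h n hmn n.lt_succ_self)]
    ring

/-- Between adjacent impressions the scan does not come around the circle. -/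
theorem Adjacent.sum_scanned_lt {I : Input A} {i n : ℕ} (h : I.Adjacent a i n) :
    ∑ t ∈ Finset.Ico (i + 1) n, I.scanned a t < I.budget a := by
  obtain ⟨hin, y, -, ⟨-, hyn⟩, hbetween⟩ := h
  have hy := I.mem_Ico_of_mem_subset hyn
  have key := I.fdist_add_sum_scanned hy (Nat.succ_le_of_lt hin) (by
    -- A scan meeting `y` in between would either put `y` into `Y_D`, so that `n` could not receive
    -- it, or semi-assign `y`, contradicting adjacency.
    intro t hit htn hinv hmem
    rw [scanned, if_pos hinv] at hmem
    have hyt : y ∈ I.subset a t := ⟨hmem, fun h => hyn.2 (I.scanState_snd_mono a htn.le h)⟩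
    rcases hinv with hd | hs
    · exact hyn.2 (I.scanState_snd_mono a (Nat.succ_le_of_lt htn)
        (I.subset_subset_of_detAssigns hd hyt))
    · exact hbetween t hit htn ⟨hs, hyt⟩)
  have h1 := fdist_nonneg (I.scanState_mem a n) hy
  have h2 := fdist_lt (I.scanState_mem a (i + 1)) hy
  linarith

/-! ### Degree bounds for the dependence graph -/

variable {I incl}

theorem Large.half_le {t : ℕ} (h : I.Large incl a t) : I.budget a / 2 ≤ I.bid a t :=
  h.elim le_of_lt fun h => h.2.ge

theorem Arc.lt {i n : ℕ} (h : I.Arc incl a i n) : i < n := h.1.1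

theorem Arc.semiAssigns_left {i n : ℕ} (h : I.Arc incl a i n) : (I.round i).SemiAssigns a := by
  obtain ⟨⟨-, y, h, -⟩, -⟩ := h
  exact h.1

theorem Arc.semiAssigns_right {i n : ℕ} (h : I.Arc incl a i n) :
    (I.round n).SemiAssigns a := by
  obtain ⟨⟨-, y, -, h, -⟩, -⟩ := h
  exact h.1

/-- Two large bids scan at least half of the circle each, whereas the total scanned in between is
strictly less than the budget. The strictness covers both conventions for large bids. -/
theorem Adjacent.not_two_large {i j k n : ℕ} (h : I.Adjacent a i n) (hij : i < j) (hjk : j < k)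
    (hkn : k < n) (hj : (I.round j).SemiAssigns a) (hk : (I.round k).SemiAssigns a)
    (hjL : I.Large incl a j) (hkL : I.Large incl a k) : False := by
  have hsub : ({j, k} : Finset ℕ) ⊆ Finset.Ico (i + 1) n := by
    intro t ht
    simp only [Finset.mem_insert, Finset.mem_singleton] at ht
    rw [Finset.mem_Ico]
    omega
  have h1 := Finset.sum_le_sum_of_subset_of_nonneg hsub fun t _ _ => I.scanned_nonneg a t
  rw [Finset.sum_pair hjk.ne] at h1
  have h2 := h.sum_scanned_lt
  have h3 := I.bid_le_scanned (Or.inr hj)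
  have h4 := I.bid_le_scanned (Or.inr hk)
  have h5 := hjL.half_le
  have h6 := hkL.half_le
  linarith

theorem Arc.arcIndex_lt_two {i n : ℕ} (h : I.Arc incl a i n) : I.arcIndex incl a i n < 2 := by
  classical
  rw [arcIndex]
  by_contra! hc
  -- Two earlier out-arcs would end at two large impressions strictly between `i` and `n`.
  obtain ⟨j, hj, k, hk, hjk⟩ := Finset.one_lt_card.1 hc
  rw [Finset.mem_filter, Finset.mem_range] at hj hk
  rcases hjk.lt_or_gt with hlt | hlt
  · exact h.1.not_two_large hj.2.lt hlt hk.1 hj.2.semiAssigns_right hk.2.semiAssigns_right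
      hj.2.2.2 hk.2.2.2
  · exact h.1.not_two_large hk.2.lt hlt hj.1 hk.2.semiAssigns_right hj.2.semiAssigns_right
      hk.2.2.2 hj.2.2.2

open Classical in
theorem card_inArcs_le_two (incl : Bool) (a : A) (n : ℕ) :
    ((Finset.range n).filter fun i => I.Arc incl a i n).card ≤ 2 := by
  set F := (Finset.range n).filter fun i => I.Arc incl a i n with hF
  by_contra! hc
  have hne : F.Nonempty := Finset.card_pos.1 (by omega)
  have hm := F.min'_mem hne
  -- Of three sources, the two later ones would lie strictly between the first one and `n`.
  have hcard : 1 < (F.erase (F.min' hne)).card := by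
    rw [Finset.card_erase_of_mem hm]; omega
  obtain ⟨j, hj, k, hk, hjk⟩ := Finset.one_lt_card.1 hcard
  have hjm := F.min'_lt_of_mem_erase_min' hne hj
  have hkm := F.min'_lt_of_mem_erase_min' hne hk
  have hj := Finset.mem_filter.1 (Finset.mem_of_mem_erase hj)
  have hk := Finset.mem_filter.1 (Finset.mem_of_mem_erase hk)
  have hm := Finset.mem_filter.1 hm
  rcases hjk.lt_or_gt with hlt | hlt
  · exact hm.2.1.not_two_large hjm hlt hk.2.lt hj.2.semiAssigns_left hk.2.semiAssigns_left
      hj.2.2.1 hk.2.2.1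
  · exact hm.2.1.not_two_large hkm hlt hj.2.lt hk.2.semiAssigns_left hj.2.semiAssigns_left
      hk.2.2.1 hj.2.2.1

theorem arcIndex_injective {i m n : ℕ} (hm : I.Arc incl a i m) (hn : I.Arc incl a i n)
    (h : I.arcIndex incl a i m = I.arcIndex incl a i n) : m = n := by
  classical
  have key : ∀ {m n : ℕ}, I.Arc incl a i m → m < n →
      I.arcIndex incl a i m < I.arcIndex incl a i n := by
    intro m n hm hlt
    apply Finset.card_lt_card
    rw [Finset.ssubset_iff_of_subset
      (Finset.filter_subset_filter _ (Finset.range_mono hlt.le))]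
    exact ⟨m, by simp [hlt, hm], by simp⟩
  rcases lt_trichotomy m n with hlt | heq | hlt
  · exact absurd h (key hm hlt).ne
  · exact heq
  · exact absurd h (key hn hlt).ne'

end Input

/-! ### Expectations as finite sums -/

section Expectation

open scoped ENNReal

variable {α β : Type*}

/-- The expectation of `g` under `μ`. -/
def ex (μ : PMF α) (g : α → ℝ≥0∞) : ℝ≥0∞ := ∑' x, μ x * g x

theorem ex_pure (x : α) (g : α → ℝ≥0∞) : ex (PMF.pure x) g = g x := by
  rw [ex, tsum_eq_single x fun y hy => by rw [PMF.pure_apply_of_ne _ _ hy, zero_mul]]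
  simp

/-- With values in `ℝ≥0∞` the order of summation can be exchanged without any summability condition.
-/
theorem ex_bind (μ : PMF α) (f : α → PMF β) (g : β → ℝ≥0∞) :
    ex (μ.bind f) g = ex μ fun x => ex (f x) g := by
  simp only [ex, PMF.bind_apply, ← ENNReal.tsum_mul_right, ← ENNReal.tsum_mul_left]
  rw [ENNReal.tsum_comm]
  simp only [mul_assoc]

theorem ex_map (μ : PMF α) (f : α → β) (g : β → ℝ≥0∞) :
    ex (μ.map f) g = ex μ fun x => g (f x) := by
  rw [← PMF.bind_pure_comp, ex_bind]
  simp only [Function.comp_apply, ex_pure]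

theorem ex_coin (p : ℝ) (hp : p ∈ Icc (0 : ℝ) 1) {g : Bool → ℝ} (hg : ∀ x, 0 ≤ g x) :
    ex (coin p hp) (fun x => ENNReal.ofReal (g x)) =
      ENNReal.ofReal (p * g true + (1 - p) * g false) := by
  have h1 : 0 ≤ 1 - p := sub_nonneg.2 hp.2
  rw [ex, tsum_fintype, Fintype.sum_bool, ENNReal.ofReal_add (mul_nonneg hp.1 (hg _))
    (mul_nonneg h1 (hg _)), ENNReal.ofReal_mul hp.1, ENNReal.ofReal_mul h1]
  rfl

theorem ex_uniformOfFinset (s : Finset α) (hs : s.Nonempty) {g : α → ℝ} (hg : ∀ x, 0 ≤ g x) :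
    ex (PMF.uniformOfFinset s hs) (fun x => ENNReal.ofReal (g x)) =
      ENNReal.ofReal ((∑ x ∈ s, g x) / s.card) := by
  have hc : (0 : ℝ) < s.card := by exact_mod_cast hs.card_pos
  rw [ex, tsum_eq_sum (s := s) fun x hx => by
      rw [PMF.uniformOfFinset_apply_of_notMem _ hx, zero_mul],
    ENNReal.ofReal_div_of_pos hc, ENNReal.ofReal_sum_of_nonneg fun x _ => hg x,
    ENNReal.ofReal_natCast, ENNReal.div_eq_inv_mul, Finset.mul_sum]
  exact Finset.sum_congr rfl fun x hx => by rw [PMF.uniformOfFinset_apply_of_mem _ hx]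

theorem ex_uniformOfFintype [Fintype α] [Nonempty α] {g : α → ℝ} (hg : ∀ x, 0 ≤ g x) :
    ex (PMF.uniformOfFintype α) (fun x => ENNReal.ofReal (g x)) =
      ENNReal.ofReal ((∑ x, g x) / Fintype.card α) :=
  ex_uniformOfFinset Finset.univ _ hg

theorem toOuterMeasure_eq_ex (μ : PMF α) (s : Set α) [DecidablePred (· ∈ s)] :
    μ.toOuterMeasure s = ex μ fun x => ENNReal.ofReal (if x ∈ s then 1 else 0) := by
  classical
  rw [PMF.toOuterMeasure_apply, ex]
  refine tsum_congr fun x => ?_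
  by_cases h : x ∈ s <;> simp [h]

end Expectation

/-! ### Expectations under the law of the algorithm -/

namespace Input

variable {A : Type*} (I : Input A) (incl : Bool) (p : ℝ)

open Classical in
/-- The expectation of `g` over the decision for impression `t` after the history `H`. -/
def dexp (H : History A) (t : ℕ) (g : Decision A → ℝ) : ℝ :=
  match I.round t with
  | .det a => g ⟨none, none, a⟩
  | .rand a₁ a₂ _ =>
    p * ((∑ c : Bool, (∑ e : Bool × Fin 2,
      g ⟨some (if e.1 = true then a₁ else a₂, e.2), none, if c = true then a₁ else a₂⟩) / 4) / 2) +
    (1 - p) * if (I.pickedInArcs incl H t a₁ a₂).Nonempty then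
        (∑ e ∈ I.pickedInArcs incl H t a₁ a₂, g ⟨none, some e,
            if H.Selected e.1 e.2 then (if e.2 = a₁ then a₂ else a₁) else e.2⟩) /
          (I.pickedInArcs incl H t a₁ a₂).card
      else (∑ c : Bool, g ⟨none, none, if c = true then a₁ else a₂⟩) / 2

/-- The expectation of `g` over the history of the first `T` impressions. -/
def lexp : ℕ → (History A → ℝ) → ℝ
  | 0, g => g fun _ => none
  | T + 1, g => lexp T fun H => I.dexp incl p H T fun d => g (Function.update H T (some d))

variable {p} (hp : p ∈ Icc (0 : ℝ) 1) {incl} {H : History A} {t : ℕ}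
include hp

theorem dexp_nonneg {g : Decision A → ℝ} (hg : ∀ d, 0 ≤ g d) : 0 ≤ I.dexp incl p H t g := by
  have h1 : 0 ≤ 1 - p := sub_nonneg.2 hp.2
  have h0 := hp.1
  unfold dexp
  split
  · exact hg _
  · refine add_nonneg (mul_nonneg h0 ?_) (mul_nonneg h1 ?_)
    · exact div_nonneg (Finset.sum_nonneg fun c _ => div_nonneg
        (Finset.sum_nonneg fun e _ => hg _) (by norm_num)) (by norm_num)
    · split_ifs
      · exact div_nonneg (Finset.sum_nonneg fun e _ => hg _) (Nat.cast_nonneg _)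
      · exact div_nonneg (Finset.sum_nonneg fun e _ => hg _) (by norm_num)

theorem ex_decide {g : Decision A → ℝ} (hg : ∀ d, 0 ≤ g d) :
    ex (I.decide incl p hp H t) (fun d => ENNReal.ofReal (g d)) =
      ENNReal.ofReal (I.dexp incl p H t g) := by
  classical
  unfold decide dexp
  rcases I.round t with a | ⟨a₁, a₂, ne⟩
  · dsimp only
    rw [ex_pure]
  · dsimp only
    rw [ex_bind]
    set F : Bool → ℝ := fun b => if b = true then
        (∑ c : Bool, (∑ e : Bool × Fin 2,
          g ⟨some (if e.1 = true then a₁ else a₂, e.2), none,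
            if c = true then a₁ else a₂⟩) / 4) / 2
      else if (I.pickedInArcs incl H t a₁ a₂).Nonempty then
        (∑ e ∈ I.pickedInArcs incl H t a₁ a₂, g ⟨none, some e,
            if H.Selected e.1 e.2 then (if e.2 = a₁ then a₂ else a₁) else e.2⟩) /
          (I.pickedInArcs incl H t a₁ a₂).card
      else (∑ c : Bool, g ⟨none, none, if c = true then a₁ else a₂⟩) / 2 with hF
    have hF0 : ∀ b, 0 ≤ F b := by
      intro b
      simp only [hF]
      split_ifs
      · exact div_nonneg (Finset.sum_nonneg fun c _ => div_nonneg
          (Finset.sum_nonneg fun e _ => hg _) (by norm_num)) (by norm_num)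
      · exact div_nonneg (Finset.sum_nonneg fun e _ => hg _) (Nat.cast_nonneg _)
      · exact div_nonneg (Finset.sum_nonneg fun e _ => hg _) (by norm_num)
    have key := ex_coin p hp hF0
    refine Eq.trans ?_ (key.trans ?_)
    · congr 1
      funext b
      cases b
      · simp only [hF, Bool.false_eq_true, if_false]
        split_ifs with h
        · rw [ex_map, ex_uniformOfFinset _ h fun e => hg _]
        · rw [ex_map, ex_uniformOfFintype fun e => hg _]
          simp
      · simp only [hF, if_true]
        rw [ex_bind]
        have h4 : ∀ c : Bool, ex ((PMF.uniformOfFintype (Bool × Fin 2)).map fun e =>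
            (⟨some (if e.1 = true then a₁ else a₂, e.2), none,
              if c = true then a₁ else a₂⟩ : Decision A)) (fun d => ENNReal.ofReal (g d)) =
            ENNReal.ofReal ((∑ e : Bool × Fin 2,
              g ⟨some (if e.1 = true then a₁ else a₂, e.2), none,
                if c = true then a₁ else a₂⟩) / 4) := by
          intro c
          rw [ex_map, ex_uniformOfFintype fun e => hg _]
          norm_num
        simp only [h4]
        rw [ex_uniformOfFintype fun c => div_nonneg
          (Finset.sum_nonneg fun e _ => hg _) (by norm_num)]
        simp
    · simp [hF]

theorem ex_law (T : ℕ) {g : History A → ℝ} (hg : ∀ H, 0 ≤ g H) :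
    ex (I.law incl p hp T) (fun H => ENNReal.ofReal (g H)) =
      ENNReal.ofReal (I.lexp incl p T g) := by
  induction T generalizing g with
  | zero => rw [law, ex_pure, lexp]
  | succ T ih =>
    rw [law, ex_bind, lexp, ← ih fun H => I.dexp_nonneg hp fun d => hg _]
    simp only [ex_map]
    congr 1
    funext H
    exact I.ex_decide hp fun d => hg _

omit hp

theorem isLinearMap_dexp (incl : Bool) (p : ℝ) (H : History A) (t : ℕ) :
    IsLinearMap ℝ (I.dexp incl p H t) := by
  constructor
  · intro g g'
    unfold dexp
    split
    · rfl
    · simp only [Pi.add_apply, Finset.sum_add_distrib, add_div]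
      split_ifs <;> ring
  · intro c g
    unfold dexp
    split
    · rfl
    · simp only [Pi.smul_apply, smul_eq_mul, ← Finset.mul_sum, mul_div_assoc]
      split_ifs <;> ring

theorem isLinearMap_lexp (incl : Bool) (p : ℝ) (T : ℕ) : IsLinearMap ℝ (I.lexp incl p T) := by
  induction T with
  | zero => exact ⟨fun _ _ => rfl, fun _ _ => rfl⟩
  | succ T ih =>
    refine ⟨fun g g' => ?_, fun c g => ?_⟩
    · simp only [lexp]
      rw [← ih.map_add]
      congr 1
      funext H
      exact (I.isLinearMap_dexp incl p H T).map_add _ _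
    · simp only [lexp]
      rw [← ih.map_smul]
      congr 1
      funext H
      exact (I.isLinearMap_dexp incl p H T).map_smul _ _

theorem lexp_sum {ι : Type*} (T : ℕ) (s : Finset ι) (g : ι → History A → ℝ) :
    I.lexp incl p T (fun H => ∑ i ∈ s, g i H) = ∑ i ∈ s, I.lexp incl p T (g i) := by
  have h := map_sum (IsLinearMap.mk' _ (I.isLinearMap_lexp incl p T)) g s
  simp only [IsLinearMap.mk'_apply] at h
  rw [← h]
  congr 1
  funext H
  rw [Finset.sum_apply]

/-- In each of the first `T` rounds the history `H` selects one of the available advertisers. -/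
def Valid (T : ℕ) (H : History A) : Prop :=
  ∀ t < T, ∃ d, H t = some d ∧ I.Involves d.choice t

variable {I} in
theorem Valid.update {T : ℕ} (h : I.Valid T H) {d : Decision A} (hd : I.Involves d.choice T) :
    I.Valid (T + 1) (Function.update H T (some d)) := by
  intro t ht
  rcases Nat.lt_succ_iff_lt_or_eq.1 ht with ht | rfl
  · obtain ⟨d', h1, h2⟩ := h t ht
    exact ⟨d', by rw [Function.update_of_ne ht.ne, h1], h2⟩
  · exact ⟨d, Function.update_self .., hd⟩

theorem dexp_congr {g g' : Decision A → ℝ} (h : ∀ d, I.Involves d.choice t → g d = g' d) :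
    I.dexp incl p H t g = I.dexp incl p H t g' := by
  classical
  unfold dexp
  split
  · rename_i a heq
    exact h _ (Or.inl (by rw [heq]; rfl))
  · rename_i a₁ a₂ _ heq
    have h' : ∀ d : Decision A, d.choice = a₁ ∨ d.choice = a₂ → g d = g' d := fun d hd =>
      h d (Or.inr (by rw [heq]; exact hd))
    have hite : ∀ c : Prop, ∀ _ : Decidable c,
        (if c then a₁ else a₂) = a₁ ∨ (if c then a₁ else a₂) = a₂ := by
      intro c _; split_ifs <;> simp
    congr 2
    · congr 1
      refine Finset.sum_congr rfl fun c _ => ?_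
      congr 1
      exact Finset.sum_congr rfl fun e _ => h' _ (hite _ _)
    · have e1 : ∀ e ∈ I.pickedInArcs incl H t a₁ a₂, g ⟨none, some e,
            if H.Selected e.1 e.2 then (if e.2 = a₁ then a₂ else a₁) else e.2⟩ =
          g' ⟨none, some e,
            if H.Selected e.1 e.2 then (if e.2 = a₁ then a₂ else a₁) else e.2⟩ := by
        intro e he
        apply h'
        have := (Finset.mem_product.1 (Finset.mem_filter.1 he).1).2
        rw [Finset.mem_insert, Finset.mem_singleton] at this
        dsimp only
        split_ifs <;> simp [this]
      rw [Finset.sum_congr rfl e1, Finset.sum_congr rfl fun c _ => h' _ (hite (c = true) _)]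

/-- Only valid histories are reachable. This matters later, because "not selecting `b`" means
"selecting the other advertiser" only on those. -/
theorem lexp_congr {T : ℕ} {g g' : History A → ℝ} (h : ∀ H, I.Valid T H → g H = g' H) :
    I.lexp incl p T g = I.lexp incl p T g' := by
  induction T generalizing g g' with
  | zero => exact h _ fun t ht => absurd ht t.not_lt_zero
  | succ T ih =>
    exact ih fun H hH => I.dexp_congr fun d hd => h _ (hH.update hd)

theorem dexp_const (c : ℝ) : I.dexp incl p H t (fun _ => c) = c := by
  classical
  unfold dexp
  split
  · rfl
  · rename_i a₁ a₂ _ _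
    split_ifs with h
    · have hc : ((I.pickedInArcs incl H t a₁ a₂).card : ℝ) ≠ 0 := by
        exact_mod_cast h.card_pos.ne'
      simp only [Finset.sum_const, nsmul_eq_mul]
      rw [mul_div_cancel_left₀ _ hc]
      simp
      ring
    · simp
      ring

theorem lexp_const (T : ℕ) (c : ℝ) : I.lexp incl p T (fun _ => c) = c := by
  induction T with
  | zero => rfl
  | succ T ih => simp only [lexp, dexp_const, ih]

theorem lexp_nonneg (hp : p ∈ Icc (0 : ℝ) 1) (T : ℕ) {g : History A → ℝ} (hg : ∀ H, 0 ≤ g H) :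
    0 ≤ I.lexp incl p T g := by
  induction T generalizing g with
  | zero => exact hg _
  | succ T ih => exact ih fun H => I.dexp_nonneg hp fun d => hg _

open Classical in
theorem assignProb_eq (hp : p ∈ Icc (0 : ℝ) 1) (T : ℕ) (a : A) (y : ℝ) :
    I.assignProb incl p hp T a y = I.lexp incl p T fun H =>
      if ∃ t < T, H.Selected t a ∧ y ∈ I.subset a t then 1 else 0 := by
  have h0 : ∀ H : History A,
      (0 : ℝ) ≤ if ∃ t < T, H.Selected t a ∧ y ∈ I.subset a t then 1 else 0 := by
    intro H; split_ifs <;> norm_num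
  rw [assignProb, toOuterMeasure_eq_ex]
  exact (congrArg _ (I.ex_law hp T h0)).trans (ENNReal.toReal_ofReal (I.lexp_nonneg hp T h0))

end Input

/-! ### Independent picks -/

/-- What a round contributes to the picked arcs: `some (a, j)` for a sender that picks its `j`-th
out-arc with respect to `a`, `none` otherwise. -/
abbrev Pick (A : Type*) := Option (A × Fin 2)

/-- The picks made in a history. -/
def History.picks {A : Type*} (H : History A) : ℕ → Pick A :=
  fun t => (H t).bind Decision.pick

theorem History.picks_update {A : Type*} (H : History A) (t : ℕ) (d : Decision A) :
    History.picks (Function.update H t (some d)) = Function.update H.picks t d.pick := by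
  funext s
  rcases eq_or_ne s t with rfl | h
  · simp [History.picks]
  · simp [History.picks, h]

open Classical in
/-- The indicator of the event that every round `t` in `S` selects `σ t`. -/
def History.sel {A : Type*} (S : Finset ℕ) (σ : ℕ → A) (H : History A) : ℝ :=
  if ∀ t ∈ S, H.Selected t (σ t) then 1 else 0

open Classical in
/-- The advertisers to which a randomized round is semi-assigned. -/
def Round.advs {A : Type*} : Round A → Finset A
  | .det _ => ∅
  | .rand a₁ a₂ _ => {a₁, a₂}

theorem Round.mem_advs {A : Type*} {r : Round A} {a : A} : a ∈ r.advs ↔ r.SemiAssigns a := by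
  cases r <;> simp [advs, SemiAssigns]

open Classical in
/-- The advertiser to which a randomized round is semi-assigned besides `b`. -/
def Round.other {A : Type*} : Round A → A → A
  | .det a, _ => a
  | .rand a₁ a₂ _, b => if b = a₁ then a₂ else a₁

/-- The expectation of `g` over the pick in the round `r`. -/
def Round.rexp {A : Type*} (p : ℝ) (r : Round A) (g : Pick A → ℝ) : ℝ :=
  match r with
  | .det _ => g none
  | .rand a₁ a₂ _ =>
    p * ((∑ e : Bool × Fin 2, g (some (if e.1 = true then a₁ else a₂, e.2))) / 4) +
      (1 - p) * g none

namespace Input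

variable {A : Type*} (I : Input A) (incl : Bool) (p : ℝ)

/-- The expectation of `g` over the independent picks in the first `T` rounds. -/
def pexp : ℕ → ((ℕ → Pick A) → ℝ) → ℝ
  | 0, g => g fun _ => none
  | T + 1, g => pexp T fun X => (I.round T).rexp p fun k => g (Function.update X T k)

/-- The picks `X` contain the arc `(i, i')_a` of `D`. -/
def PicksArc (X : ℕ → Pick A) (a : A) (i i' : ℕ) : Prop :=
  I.Arc incl a i i' ∧ ∃ j : Fin 2, X i = some (a, j) ∧ (j : ℕ) = I.arcIndex incl a i i'

theorem picks_iff {H : History A} {a : A} {i i' : ℕ} :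
    I.Picks incl H a i i' ↔ I.PicksArc incl H.picks a i i' := by
  refine and_congr_right fun _ => ⟨?_, ?_⟩
  · rintro ⟨d, j, h1, h2, h3⟩
    exact ⟨j, by simp [History.picks, h1, h2], h3⟩
  · rintro ⟨j, h1, h2⟩
    obtain ⟨d, hd, hd'⟩ := Option.bind_eq_some_iff.1 h1
    exact ⟨d, j, hd, hd', h2⟩

open Classical in
/-- The picked in-arcs of `t`. -/
def inArcs (X : ℕ → Pick A) (t : ℕ) : Finset (ℕ × A) :=
  (Finset.range t ×ˢ (I.round t).advs).filter fun e => I.PicksArc incl X e.2 e.1 t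

open Classical in
/-- The conditional probability, given the picks `X`, that the impression `t` is not matched along an
in-arc from an impression in `S`. -/
def weight (S : Finset ℕ) (X : ℕ → Pick A) (t : ℕ) : ℝ :=
  if X t = none ∧ (I.inArcs incl X t).Nonempty then
    (((I.inArcs incl X t).filter fun e => e.1 ∉ S).card : ℝ) / (I.inArcs incl X t).card
  else 1

open Classical in
/-- If an impression is matched along the in-arc `e = (i, b)`, then it selects `c` if and only if `i`
selects this advertiser. -/
def required (c : A) (e : ℕ × A) : A := if c = e.2 then (I.round e.1).other e.2 else e.2

variable {I incl}

theorem PicksArc.congr {X X' : ℕ → Pick A} {a : A} {i i' : ℕ} (h : X i = X' i) :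
    I.PicksArc incl X a i i' ↔ I.PicksArc incl X' a i i' := by
  rw [PicksArc, PicksArc, h]

theorem PicksArc.ne_none {X : ℕ → Pick A} {a : A} {i i' : ℕ} (h : I.PicksArc incl X a i i') :
    X i ≠ none := by
  obtain ⟨-, j, hj, -⟩ := h
  simp [hj]

/-- A sender makes one pick, and the position of an arc determines its target. Both the recursion
over sources and the negative correlation of the picks rest on this. -/
theorem PicksArc.unique {X : ℕ → Pick A} {a b : A} {i m n : ℕ} (hm : I.PicksArc incl X a i m)
    (hn : I.PicksArc incl X b i n) : a = b ∧ m = n := by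
  obtain ⟨hm, j, hj, hj'⟩ := hm
  obtain ⟨hn, k, hk, hk'⟩ := hn
  rw [hj, Option.some_inj, Prod.mk_inj] at hk
  obtain ⟨rfl, rfl⟩ := hk
  exact ⟨rfl, arcIndex_injective hm hn (hj'.symm.trans hk')⟩

theorem mem_inArcs {X : ℕ → Pick A} {t : ℕ} {e : ℕ × A} :
    e ∈ I.inArcs incl X t ↔ I.PicksArc incl X e.2 e.1 t := by
  classical
  rw [inArcs, Finset.mem_filter, Finset.mem_product, Finset.mem_range, Round.mem_advs]
  exact and_iff_right_of_imp fun h => ⟨h.1.lt, h.1.semiAssigns_right⟩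

theorem inArcs_congr {X X' : ℕ → Pick A} {t : ℕ} (h : ∀ s < t, X s = X' s) :
    I.inArcs incl X t = I.inArcs incl X' t := by
  ext e
  rw [mem_inArcs, mem_inArcs]
  exact ⟨fun he => (PicksArc.congr (h _ he.1.lt)).1 he,
    fun he => (PicksArc.congr (h _ he.1.lt)).2 he⟩

theorem inArcs_update {X : ℕ → Pick A} {s t : ℕ} (h : t ≤ s) (k : Pick A) :
    I.inArcs incl (Function.update X s k) t = I.inArcs incl X t :=
  inArcs_congr fun _ hr => Function.update_of_ne (hr.trans_le h).ne _ _

theorem weight_congr {S S' : Finset ℕ} {X X' : ℕ → Pick A} {t : ℕ} (h : ∀ s ≤ t, X s = X' s)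
    (hS : ∀ e ∈ I.inArcs incl X t, e.1 ∈ S ↔ e.1 ∈ S') :
    I.weight incl S X t = I.weight incl S' X' t := by
  classical
  rw [weight, weight, h t le_rfl, ← inArcs_congr (X := X) (X' := X') fun s hs => h s hs.le,
    Finset.filter_congr fun e he => not_congr (hS e he)]

theorem pickedInArcs_eq {H : History A} {t : ℕ} {a₁ a₂ : A} {ne : a₁ ≠ a₂}
    (h : I.round t = .rand a₁ a₂ ne) :
    I.pickedInArcs incl H t a₁ a₂ = I.inArcs incl H.picks t := by
  classical
  ext e
  rw [mem_inArcs, pickedInArcs, Finset.mem_filter, picks_iff, Finset.mem_product,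
    Finset.mem_range]
  refine and_iff_right_of_imp fun he => ⟨he.1.lt, ?_⟩
  have := he.1.semiAssigns_right
  rw [h] at this
  simpa [Round.SemiAssigns] using this

theorem Valid.selected_other {T s : ℕ} {b : A} {H : History A} (hH : I.Valid T H) (hs : s < T)
    (hb : (I.round s).SemiAssigns b) :
    H.Selected s ((I.round s).other b) ↔ ¬ H.Selected s b := by
  obtain ⟨d, hd, hinv⟩ := hH s hs
  have key : ∀ c, H.Selected s c ↔ d.choice = c := by
    intro c
    constructor
    · rintro ⟨d', h1, h2⟩
      rw [hd, Option.some_inj] at h1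
      rwa [h1]
    · exact fun h => ⟨d, hd, h⟩
  rw [key, key]
  rw [Involves] at hinv
  revert hb hinv
  generalize I.round s = r
  rcases r with a | ⟨a₁, a₂, ne⟩
  · exact fun hb => hb.elim
  · rintro (rfl | rfl) (h | h | h)
    · exact h.elim
    · simp [Round.other, h, ne]
    · simp [Round.other, h, ne.symm]
    · exact h.elim
    · simp [Round.other, h, ne.symm, ne]
    · simp [Round.other, h, ne.symm]

/-- Exactly one of receiver and source selects the label `e.2`, so a condition on the receiver
translates into a condition on the source. -/
theorem matched_choice_eq_iff {T : ℕ} {H : History A} (hH : I.Valid T H) {a₁ a₂ c : A}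
    {ne : a₁ ≠ a₂} (hr : I.round T = .rand a₁ a₂ ne) (hc : (I.round T).SemiAssigns c)
    {e : ℕ × A} (he : I.Arc incl e.2 e.1 T) [Decidable (H.Selected e.1 e.2)]
    [Decidable (e.2 = a₁)] :
    (if H.Selected e.1 e.2 then (if e.2 = a₁ then a₂ else a₁) else e.2) = c ↔
      H.Selected e.1 (I.required c e) := by
  have hb := he.semiAssigns_right
  rw [hr] at hb hc
  rw [required]
  split_ifs with h1 h2 h3 h3 h3
  · rw [hH.selected_other he.lt he.semiAssigns_left]
    simp only [h1, not_true, iff_false]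
    rw [h3, h2]; exact ne.symm
  · simp only [h1, iff_true]
    rcases hc with rfl | rfl
    · exact absurd h2.symm h3
    · rfl
  · rw [hH.selected_other he.lt he.semiAssigns_left]
    simp only [h1, not_true, iff_false]
    rw [h3]; exact fun h => h2 h.symm
  · simp only [h1, iff_true]
    rcases hc with rfl | rfl
    · rfl
    · exact absurd (hb.resolve_left h2).symm h3
  · rw [hH.selected_other he.lt he.semiAssigns_left]
    simp [h1, h3]
  · simp only [h1, iff_false]
    exact fun h => h3 h.symm

variable (I)

/-- The history influences only how a receiver selects, and a receiver never picks; hence the picks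
are independent across rounds. -/
theorem dexp_pick (H : History A) (t : ℕ) (g : Pick A → ℝ) :
    I.dexp incl p H t (fun d => g d.pick) = (I.round t).rexp p g := by
  classical
  unfold dexp Round.rexp
  rcases I.round t with a | ⟨a₁, a₂, ne⟩
  · rfl
  · dsimp only
    split_ifs with h
    · have hc : ((I.pickedInArcs incl H t a₁ a₂).card : ℝ) ≠ 0 := by
        exact_mod_cast h.card_pos.ne'
      rw [Finset.sum_const, Finset.sum_const, nsmul_eq_mul, nsmul_eq_mul,
        mul_div_cancel_left₀ _ hc, Finset.card_univ, Fintype.card_bool]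
      push_cast
      ring
    · rw [Finset.sum_const, Finset.sum_const, nsmul_eq_mul, nsmul_eq_mul,
        Finset.card_univ, Fintype.card_bool]
      push_cast
      ring

open Classical in
-- A sender or an unmatched receiver uses a fair bit, which gives the first term. A matched receiver
-- copies or reverses its source, which gives one summand for each picked in-arc.
theorem dexp_pick_mul_choice {T : ℕ} {H : History A} (hH : I.Valid T H) {c : A}
    (hc : (I.round T).SemiAssigns c) (g : Pick A → ℝ) :
    I.dexp incl p H T (fun d => g d.pick * if d.choice = c then 1 else 0) =
      (I.round T).rexp p (fun k => g k *
        if k = none ∧ (I.inArcs incl H.picks T).Nonempty then 0 else 1 / 2) +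
      ∑ e ∈ Finset.range T ×ˢ (I.round T).advs,
        ((1 - p) * g none * if e ∈ I.inArcs incl H.picks T then
          1 / ((I.inArcs incl H.picks T).card : ℝ) else 0) *
          if H.Selected e.1 (I.required c e) then 1 else 0 := by
  have hsum : ∀ f : ℕ × A → ℝ, ∑ e ∈ Finset.range T ×ˢ (I.round T).advs,
        ((1 - p) * g none * if e ∈ I.inArcs incl H.picks T then
          1 / ((I.inArcs incl H.picks T).card : ℝ) else 0) * f e =
      (1 - p) * g none * ((∑ e ∈ I.inArcs incl H.picks T, f e) /
        (I.inArcs incl H.picks T).card) := by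
    intro f
    rw [Finset.sum_div, Finset.mul_sum, ← Finset.sum_subset
      (s₁ := I.inArcs incl H.picks T) (Finset.filter_subset _ _)]
    · refine Finset.sum_congr rfl fun e he => ?_
      rw [if_pos he]
      ring
    · intro e _ he
      rw [if_neg he]
      ring
  rw [hsum]
  obtain ⟨a₁, a₂, ne, hr⟩ : ∃ a₁ a₂ ne, I.round T = .rand a₁ a₂ ne := by
    rcases h : I.round T with a | ⟨a₁, a₂, ne⟩
    · rw [h] at hc; exact hc.elim
    · exact ⟨a₁, a₂, ne, rfl⟩
  have hbool : ∑ x : Bool, (if (if x = true then a₁ else a₂) = c then (1 : ℝ) else 0) = 1 := by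
    rw [hr] at hc
    rcases hc with rfl | rfl <;> simp [ne, ne.symm]
  have hin := pickedInArcs_eq (incl := incl) (H := H) hr
  have hmatch : ∑ e ∈ I.inArcs incl H.picks T, (if (if H.Selected e.1 e.2 then
        (if e.2 = a₁ then a₂ else a₁) else e.2) = c then (1 : ℝ) else 0) =
      ∑ e ∈ I.inArcs incl H.picks T,
        if H.Selected e.1 (I.required c e) then 1 else 0 := by
    refine Finset.sum_congr rfl fun e he => ?_
    exact if_congr (matched_choice_eq_iff hH hr hc (mem_inArcs.1 he).1) rfl rfl
  have hsend : ∀ x : Bool, (∑ e : Bool × Fin 2, g (some (if e.1 = true then a₁ else a₂, e.2)) *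
      if (if x = true then a₁ else a₂) = c then (1 : ℝ) else 0) / 4 =
      (∑ e : Bool × Fin 2, g (some (if e.1 = true then a₁ else a₂, e.2))) / 4 *
      if (if x = true then a₁ else a₂) = c then (1 : ℝ) else 0 := by
    intro x
    rw [← Finset.sum_mul]
    ring
  unfold dexp Round.rexp
  simp only [hr, hin]
  rw [Finset.sum_congr rfl fun x _ => hsend x, ← Finset.mul_sum, ← Finset.mul_sum, ← Finset.mul_sum,
    hbool, hmatch]
  by_cases hne : (I.inArcs incl H.picks T).Nonempty
  · simp only [hne, if_true, and_self, reduceCtorEq, false_and, if_false]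
    rw [← Finset.sum_mul]
    ring
  · rw [Finset.not_nonempty_iff_eq_empty] at hne
    simp only [hne, Finset.not_nonempty_empty, and_false, if_false, Finset.sum_empty]
    rw [← Finset.sum_mul]
    ring

theorem isLinearMap_rexp (r : Round A) : IsLinearMap ℝ (r.rexp p) := by
  rcases r with a | ⟨a₁, a₂, ne⟩
  · exact ⟨fun _ _ => rfl, fun _ _ => rfl⟩
  · refine ⟨fun g g' => ?_, fun c g => ?_⟩
    · simp only [Round.rexp, Pi.add_apply, Finset.sum_add_distrib]
      ring
    · simp only [Round.rexp, Pi.smul_apply, smul_eq_mul, ← Finset.mul_sum]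
      ring

theorem isLinearMap_pexp (T : ℕ) : IsLinearMap ℝ (I.pexp p T) := by
  induction T with
  | zero => exact ⟨fun _ _ => rfl, fun _ _ => rfl⟩
  | succ T ih =>
    refine ⟨fun g g' => ?_, fun c g => ?_⟩
    · simp only [pexp]
      rw [← ih.map_add]
      congr 1
      funext X
      exact (isLinearMap_rexp p (I.round T)).map_add _ _
    · simp only [pexp]
      rw [← ih.map_smul]
      congr 1
      funext X
      exact (isLinearMap_rexp p (I.round T)).map_smul _ _

theorem pexp_sum {ι : Type*} (T : ℕ) (s : Finset ι) (g : ι → (ℕ → Pick A) → ℝ) :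
    I.pexp p T (fun X => ∑ i ∈ s, g i X) = ∑ i ∈ s, I.pexp p T (g i) := by
  have h := map_sum (IsLinearMap.mk' _ (I.isLinearMap_pexp p T)) g s
  simp only [IsLinearMap.mk'_apply] at h
  rw [← h]
  congr 1
  funext X
  rw [Finset.sum_apply]

end Input

/-! ### From histories to independent picks -/

section Selected

variable {A : Type*} {H : History A} {t T : ℕ} {a b : A} {S : Finset ℕ} {σ : ℕ → A}

theorem History.Selected.unique (ha : H.Selected t a) (hb : H.Selected t b) : a = b := by
  obtain ⟨d, h1, rfl⟩ := ha
  obtain ⟨d', h2, rfl⟩ := hb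
  rw [h1, Option.some_inj] at h2
  rw [h2]

theorem History.selected_update_self {d : Decision A} :
    History.Selected (Function.update H T (some d)) T a ↔ d.choice = a := by
  simp [Selected]

theorem History.selected_update_of_ne {d : Decision A} (h : t ≠ T) :
    History.Selected (Function.update H T (some d)) t a ↔ H.Selected t a := by
  simp [Selected, h]

theorem History.sel_update_of_notMem {d : Decision A} (h : T ∉ S) :
    History.sel S σ (Function.update H T (some d)) = H.sel S σ := by
  classical
  unfold sel
  refine if_congr (forall₂_congr fun t ht => selected_update_of_ne ?_) rfl rfl
  rintro rfl
  exact h ht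

open Classical in
theorem History.sel_insert : H.sel (insert T S) σ =
    (if H.Selected T (σ T) then 1 else 0) * H.sel S σ := by
  simp only [sel, Finset.forall_mem_insert]
  split_ifs <;> simp_all

theorem History.sel_update_value (h : T ∉ S) : H.sel S (Function.update σ T a) = H.sel S σ := by
  classical
  unfold sel
  refine if_congr (forall₂_congr fun t ht => ?_) rfl rfl
  rw [Function.update_of_ne]
  rintro rfl
  exact h ht

end Selected

namespace Input

variable {A : Type*} {I : Input A} {incl : Bool} {p : ℝ}

theorem semiAssigns_required {c : A} {e : ℕ × A} (h : (I.round e.1).SemiAssigns e.2) :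
    (I.round e.1).SemiAssigns (I.required c e) := by
  unfold required
  split_ifs
  · revert h
    generalize I.round e.1 = r
    rcases r with a | ⟨a₁, a₂, ne⟩
    · exact id
    · intro _
      unfold Round.other
      dsimp only
      split_ifs
      · exact Or.inr rfl
      · exact Or.inl rfl
  · exact h

/-- In the picks `X` no two impressions of `S` that select the advertisers `σ` can be matched. -/
def Conflicting (I : Input A) (incl : Bool) (S : Finset ℕ) (σ : ℕ → A) (X : ℕ → Pick A) : Prop :=
  ∀ t ∈ S, X t = none → ∀ e ∈ I.inArcs incl X t, e.1 ∈ S → σ e.1 ≠ I.required (σ t) e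

theorem Conflicting.of_update {S S' : Finset ℕ} {σ : ℕ → A} {X : ℕ → Pick A} {T : ℕ} {k : Pick A}
    (h : I.Conflicting incl S' σ (Function.update X T k)) (hS : S ⊆ S') (hT : ∀ t ∈ S, t < T) :
    I.Conflicting incl S σ X := by
  intro t ht hX e he heS
  refine h t (hS ht) ?_ e ?_ (hS heS)
  · rwa [Function.update_of_ne (hT t ht).ne]
  · rwa [inArcs_update (hT t ht).le]

theorem rexp_zero (r : Round A) : r.rexp p (fun _ => 0) = 0 :=
  (isLinearMap_rexp p r).map_zero

theorem rexp_mul_const (r : Round A) (g : Pick A → ℝ) (c : ℝ) :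
    r.rexp p (fun k => g k * c) = r.rexp p g * c := by
  rw [mul_comm, ← smul_eq_mul, ← (isLinearMap_rexp p r).map_smul]
  congr 1
  funext k
  simp [mul_comm]

open Classical in
theorem rexp_none {r : Round A} {c : A} (hr : r.SemiAssigns c) (g : Pick A → ℝ) :
    r.rexp p (fun k => g k * if k = none then 1 else 0) = (1 - p) * g none := by
  rcases r with a | ⟨a₁, a₂, ne⟩
  · exact hr.elim
  · simp [Round.rexp]

theorem dexp_mul_const (H : History A) (t : ℕ) (g : Decision A → ℝ) (c : ℝ) :
    I.dexp incl p H t (fun d => g d * c) = I.dexp incl p H t g * c := by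
  rw [mul_comm, ← smul_eq_mul, ← (I.isLinearMap_dexp incl p H t).map_smul]
  congr 1
  funext k
  simp [mul_comm]

theorem exists_of_rexp_ne_zero {r : Round A} {g h : Pick A → ℝ}
    (hne : r.rexp p (fun k => g k * h k) ≠ 0) : ∃ k, g k ≠ 0 := by
  by_contra! h0
  simp only [h0, zero_mul, rexp_zero, ne_eq, not_true] at hne

/-- The probability, up to the factor `2^{-|S|}`, that the impressions in `S` are not matched with
each other, given the picks `X`. -/
def weights (I : Input A) (incl : Bool) (S : Finset ℕ) (X : ℕ → Pick A) : ℝ :=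
  (1 / 2) ^ S.card * ∏ t ∈ S, I.weight incl S X t

theorem weights_update_of_lt {S : Finset ℕ} {T : ℕ} (hS : ∀ t ∈ S, t < T) (X : ℕ → Pick A)
    (k : Pick A) : I.weights incl S (Function.update X T k) = I.weights incl S X := by
  unfold weights
  congr 1
  refine Finset.prod_congr rfl fun t ht => ?_
  exact weight_congr (fun s hs => Function.update_of_ne (hs.trans_lt (hS t ht)).ne _ _)
    fun _ _ => Iff.rfl

open Classical in
theorem weights_insert_update {S : Finset ℕ} {T : ℕ} (hS : ∀ t ∈ S, t < T) (X : ℕ → Pick A)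
    (k : Pick A) : I.weights incl (insert T S) (Function.update X T k) =
      I.weights incl S X * (1 / 2) * if k = none ∧ (I.inArcs incl X T).Nonempty then
        (((I.inArcs incl X T).filter fun e => e.1 ∉ S).card : ℝ) / (I.inArcs incl X T).card
      else 1 := by
  have hT : T ∉ S := fun h => (hS T h).false
  have hw : ∀ t ∈ S, I.weight incl (insert T S) (Function.update X T k) t =
      I.weight incl S X t := by
    intro t ht
    refine weight_congr (fun s hs => Function.update_of_ne (hs.trans_lt (hS t ht)).ne _ _) ?_
    intro e he
    rw [Finset.mem_insert, or_iff_right]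
    exact ((mem_inArcs.1 he).1.lt.trans (hS t ht)).ne
  have hfil : (I.inArcs incl X T).filter (fun e => e.1 ∉ insert T S) =
      (I.inArcs incl X T).filter fun e => e.1 ∉ S := by
    refine Finset.filter_congr fun e he => ?_
    rw [Finset.mem_insert, or_iff_right (mem_inArcs.1 he).1.lt.ne]
  rw [weights, Finset.card_insert_of_notMem hT, Finset.prod_insert hT, Finset.prod_congr rfl hw,
    weights, weight, inArcs_update le_rfl, Function.update_self, hfil]
  ring

/-- The new member `s` is a sender, so its own weight is 1; its only picked arc ends at `T`, after
all of `S`, so no other weight notices it. -/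
theorem weights_insert_source {S : Finset ℕ} {s T : ℕ} {b : A} (hS : ∀ t ∈ S, t < T)
    (hs : s ∉ S) {X : ℕ → Pick A} (h : I.PicksArc incl X b s T) :
    I.weights incl (insert s S) X = I.weights incl S X * (1 / 2) := by
  have hw : ∀ t ∈ S, I.weight incl (insert s S) X t = I.weight incl S X t := by
    intro t ht
    refine weight_congr (fun _ _ => rfl) ?_
    intro e he
    rw [Finset.mem_insert, or_iff_right]
    rintro rfl
    exact (hS t ht).ne (h.unique (mem_inArcs.1 he)).2.symm
  rw [weights, Finset.card_insert_of_notMem hs, Finset.prod_insert hs, Finset.prod_congr rfl hw,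
    weights, weight, if_neg fun h' => h.ne_none h'.1]
  ring

open Classical in
/-- The contribution of the receiver `T` matched along the in-arc `e`. -/
theorem lexp_matched {T : ℕ} {S : Finset ℕ} {σ : ℕ → A} {c : A} {Φ : (ℕ → Pick A) → ℝ}
    (ih : ∀ {S : Finset ℕ} {σ : ℕ → A} {Φ : (ℕ → Pick A) → ℝ},
      (∀ t ∈ S, t < T ∧ (I.round t).SemiAssigns (σ t)) →
      (∀ X, Φ X ≠ 0 → I.Conflicting incl S σ X) →
      I.lexp incl p T (fun H => Φ H.picks * H.sel S σ) =
        I.pexp p T fun X => Φ X * I.weights incl S X)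
    (hS : ∀ t ∈ S, t < T ∧ (I.round t).SemiAssigns (σ t)) (e : ℕ × A)
    (hΦe : ∀ X, Φ X ≠ 0 → e ∈ I.inArcs incl X T ∧ (e.1 ∈ S → σ e.1 ≠ I.required c e))
    (hΦ : ∀ X, Φ X ≠ 0 → I.Conflicting incl S σ X) :
    I.lexp incl p T (fun H => Φ H.picks *
        ((if H.Selected e.1 (I.required c e) then 1 else 0) * H.sel S σ)) =
      I.pexp p T fun X => Φ X * if e.1 ∈ S then 0 else I.weights incl S X * (1 / 2) := by
  by_cases hz : ∀ X, Φ X = 0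
  · simp only [hz, zero_mul]
    rw [lexp_const]
    exact ((I.isLinearMap_pexp p T).map_zero).symm
  -- A single point where `Φ` is nonzero shows that `e` is an arc of `D` into `T`, a fact
  -- independent of the picks.
  obtain ⟨X₀, hX₀⟩ := not_forall.1 hz
  have harc := (mem_inArcs.1 (hΦe X₀ hX₀).1).1
  -- A source in `S` would have to select two different advertisers, so the term vanishes. A source
  -- outside `S` joins `S` with the selection forced by the match.
  by_cases heS : e.1 ∈ S
  · simp only [heS, if_true, mul_zero]
    refine Eq.trans ?_ ((I.isLinearMap_pexp p T).map_zero).symm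
    refine Eq.trans ?_ (I.lexp_const (incl := incl) (p := p) T 0)
    congr 1
    funext H
    by_cases h0 : Φ H.picks = 0
    · rw [h0, zero_mul]
    have hne := (hΦe _ h0).2 heS
    unfold History.sel
    split_ifs with h1 h2
    · exact absurd ((h2 _ heS).unique h1) hne
    all_goals simp
  · have key := ih (S := insert e.1 S) (σ := Function.update σ e.1 (I.required c e)) (Φ := Φ)
      (by
        intro t ht
        rcases Finset.mem_insert.1 ht with rfl | ht
        · rw [Function.update_self]
          exact ⟨harc.lt, semiAssigns_required harc.semiAssigns_left⟩
        · rw [Function.update_of_ne (ne_of_mem_of_not_mem ht heS)]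
          exact hS t ht)
      (by
        intro X hX t ht hXt e' he' he'S
        have hp := mem_inArcs.1 (hΦe X hX).1
        have hte : t ≠ e.1 := by
          rintro rfl
          exact hp.ne_none hXt
        have htS := Finset.mem_of_mem_insert_of_ne ht hte
        have hee : e'.1 ≠ e.1 := by
          intro h
          have hp' := mem_inArcs.1 he'
          rw [h] at hp'
          exact (hS t htS).1.ne (hp.unique hp').2.symm
        rw [Function.update_of_ne hte, Function.update_of_ne hee]
        exact hΦ X hX t htS hXt e' he' (Finset.mem_of_mem_insert_of_ne he'S hee))
    simp only [History.sel_insert, Function.update_self, History.sel_update_value heS] at key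
    rw [key]
    congr 1
    funext X
    rw [if_neg heS]
    by_cases h0 : Φ X = 0
    · rw [h0, zero_mul, zero_mul]
    · rw [weights_insert_source (fun t ht => (hS t ht).1) heS (mem_inArcs.1 (hΦe X h0).1)]

open Classical in
/-- The step of `lexp_picks_mul_sel` for a round in `S`. -/
theorem lexp_succ_picks_mul_sel_insert {T : ℕ} {S : Finset ℕ} {σ : ℕ → A}
    {Φ : (ℕ → Pick A) → ℝ}
    (ih : ∀ {S : Finset ℕ} {σ : ℕ → A} {Φ : (ℕ → Pick A) → ℝ},
      (∀ t ∈ S, t < T ∧ (I.round t).SemiAssigns (σ t)) →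
      (∀ X, Φ X ≠ 0 → I.Conflicting incl S σ X) →
      I.lexp incl p T (fun H => Φ H.picks * H.sel S σ) =
        I.pexp p T fun X => Φ X * I.weights incl S X)
    (hS : ∀ t ∈ S, t < T ∧ (I.round t).SemiAssigns (σ t))
    (hT : (I.round T).SemiAssigns (σ T))
    (hΦ : ∀ X, Φ X ≠ 0 → I.Conflicting incl (insert T S) σ X) :
    I.lexp incl p (T + 1) (fun H => Φ H.picks * H.sel (insert T S) σ) =
      I.pexp p (T + 1) fun X => Φ X * I.weights incl (insert T S) X := by
  have hTS : T ∉ S := fun h => (hS T h).1.false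
  have hlt : ∀ t ∈ S, t < T := fun t ht => (hS t ht).1
  -- `F` collects the cases in which `T` uses its own fair bit; `G e` is the case of a match along
  -- `e`. Both depend on the picks before `T` only through `X`, so the induction hypothesis applies
  -- to them as new `Φ`.
  set F : (ℕ → Pick A) → ℝ := fun X => (I.round T).rexp p fun k => Φ (Function.update X T k) *
    if k = none ∧ (I.inArcs incl X T).Nonempty then 0 else 1 / 2 with hF
  set G : ℕ × A → (ℕ → Pick A) → ℝ := fun e X => (1 - p) * Φ (Function.update X T none) *
    if e ∈ I.inArcs incl X T then 1 / ((I.inArcs incl X T).card : ℝ) else 0 with hG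
  have hFc : ∀ X, F X ≠ 0 → I.Conflicting incl S σ X := by
    intro X hX
    obtain ⟨k, hk⟩ := exists_of_rexp_ne_zero hX
    exact (hΦ _ hk).of_update (Finset.subset_insert _ _) hlt
  have hG0 : ∀ e X, G e X ≠ 0 → Φ (Function.update X T none) ≠ 0 ∧ e ∈ I.inArcs incl X T := by
    intro e X h
    simp only [hG] at h
    refine ⟨right_ne_zero_of_mul (left_ne_zero_of_mul h), ?_⟩
    by_contra he
    rw [if_neg he] at h
    exact h (mul_zero _)
  have hL : I.lexp incl p (T + 1) (fun H => Φ H.picks * H.sel (insert T S) σ) =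
      I.lexp incl p T fun H => F H.picks * H.sel S σ +
        ∑ e ∈ Finset.range T ×ˢ (I.round T).advs, G e H.picks *
          ((if H.Selected e.1 (I.required (σ T) e) then 1 else 0) * H.sel S σ) := by
    rw [lexp]
    refine I.lexp_congr fun H hH => ?_
    have h1 : ∀ d : Decision A, Φ (History.picks (Function.update H T (some d))) *
        History.sel (insert T S) σ (Function.update H T (some d)) =
        Φ (Function.update H.picks T d.pick) * (if d.choice = σ T then 1 else 0) *
          H.sel S σ := by
      intro d
      rw [History.picks_update, History.sel_insert, History.sel_update_of_notMem hTS,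
        mul_assoc]
      simp only [History.selected_update_self]
    simp only [h1]
    rw [dexp_mul_const, I.dexp_pick_mul_choice p hH hT fun k => Φ (Function.update H.picks T k),
      add_mul, Finset.sum_mul]
    simp only [hF, hG, mul_assoc]
  have hR : I.pexp p (T + 1) (fun X => Φ X * I.weights incl (insert T S) X) =
      I.pexp p T fun X => F X * I.weights incl S X +
        ∑ e ∈ Finset.range T ×ˢ (I.round T).advs, G e X *
          if e.1 ∈ S then 0 else I.weights incl S X * (1 / 2) := by
    rw [pexp]
    congr 1
    funext X
    simp only [weights_insert_update hlt]
    -- Summing over the picked arcs from outside `S` produces the fraction in the weight of `T`.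
    have hs : ∑ e ∈ Finset.range T ×ˢ (I.round T).advs, G e X *
          (if e.1 ∈ S then 0 else I.weights incl S X * (1 / 2)) =
        (1 - p) * (Φ (Function.update X T none) * (I.weights incl S X * (1 / 2) *
          ((((I.inArcs incl X T).filter fun e => e.1 ∉ S).card : ℝ) /
            (I.inArcs incl X T).card))) := by
      rw [Finset.cast_card, Finset.sum_div, Finset.mul_sum, Finset.mul_sum, Finset.mul_sum,
        Finset.sum_filter, ← Finset.sum_subset
        (s₁ := I.inArcs incl X T) (Finset.filter_subset _ _)]
      · refine Finset.sum_congr rfl fun e he => ?_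
        simp only [hG, he, if_true]
        split_ifs with h
        · ring
        · ring
      · intro e _ he
        simp only [hG, he, if_false, mul_zero, zero_mul]
    rw [hs, ← rexp_none hT fun k => Φ (Function.update X T k) * (I.weights incl S X * (1 / 2) *
          ((((I.inArcs incl X T).filter fun e => e.1 ∉ S).card : ℝ) /
            (I.inArcs incl X T).card)), hF]
    dsimp only
    rw [← rexp_mul_const, ← (isLinearMap_rexp p (I.round T)).map_add]
    congr 1
    funext k
    rw [Pi.add_apply]
    by_cases hne : (I.inArcs incl X T).Nonempty
    · by_cases hk : k = none
      · simp [hne, hk]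
      · simp [hk]; ring
    · rw [Finset.not_nonempty_iff_eq_empty] at hne
      simp [hne]; ring
  have hadd : ∀ f g : History A → ℝ, I.lexp incl p T (fun H => f H + g H) =
      I.lexp incl p T f + I.lexp incl p T g := (I.isLinearMap_lexp incl p T).map_add
  have hadd' : ∀ f g : (ℕ → Pick A) → ℝ, I.pexp p T (fun H => f H + g H) =
      I.pexp p T f + I.pexp p T g := (I.isLinearMap_pexp p T).map_add
  rw [hL, hR, hadd, hadd', lexp_sum, pexp_sum, ih hS hFc]
  congr 1
  refine Finset.sum_congr rfl fun e _ => lexp_matched ih hS e ?_ ?_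
  · intro X hX
    obtain ⟨h1, h2⟩ := hG0 e X hX
    refine ⟨h2, fun heS => hΦ _ h1 T (Finset.mem_insert_self _ _) (Function.update_self ..) e ?_
      (Finset.mem_insert_of_mem heS)⟩
    rwa [inArcs_update le_rfl]
  · exact fun X hX => (hΦ _ (hG0 e X hX).1).of_update (Finset.subset_insert _ _) hlt

/-- If no two impressions of `S` that select the advertisers `σ` can be matched, then the probability
that all of them do so is determined by the independent picks. -/
theorem lexp_picks_mul_sel {T : ℕ} {S : Finset ℕ} {σ : ℕ → A} {Φ : (ℕ → Pick A) → ℝ}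
    (hS : ∀ t ∈ S, t < T ∧ (I.round t).SemiAssigns (σ t))
    (hΦ : ∀ X, Φ X ≠ 0 → I.Conflicting incl S σ X) :
    I.lexp incl p T (fun H => Φ H.picks * H.sel S σ) =
      I.pexp p T fun X => Φ X * I.weights incl S X := by
  classical
  induction T generalizing S σ Φ with
  | zero =>
    obtain rfl : S = ∅ := Finset.eq_empty_of_forall_notMem fun t ht => (hS t ht).1.not_ge t.zero_le
    simp only [lexp, pexp, weights, History.sel]
    simp
    rfl
  | succ T ih =>
    by_cases hT : T ∈ S
    · obtain ⟨S', hTS', rfl⟩ : ∃ S', T ∉ S' ∧ S = insert T S' :=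
        ⟨S.erase T, Finset.notMem_erase _ _, (Finset.insert_erase hT).symm⟩
      refine lexp_succ_picks_mul_sel_insert ih ?_ (hS T hT).2 hΦ
      intro t ht
      have h := hS t (Finset.mem_insert_of_mem ht)
      refine ⟨(Nat.lt_succ_iff.1 h.1).lt_of_ne ?_, h.2⟩
      rintro rfl
      exact hTS' ht
    · have hlt : ∀ t ∈ S, t < T := by
        intro t ht
        refine (Nat.lt_succ_iff.1 (hS t ht).1).lt_of_ne ?_
        rintro rfl
        exact hT ht
      rw [lexp, pexp]
      simp only [History.picks_update, History.sel_update_of_notMem hT,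
        weights_update_of_lt hlt, dexp_mul_const, rexp_mul_const]
      refine Eq.trans (congrArg _ (funext fun H => congrArg (· * H.sel S σ)
        (I.dexp_pick p H T fun k => Φ (Function.update H.picks T k)))) ?_
      refine ih (Φ := fun X => (I.round T).rexp p fun k => Φ (Function.update X T k))
        (fun t ht => ⟨hlt t ht, (hS t ht).2⟩) fun X hX => ?_
      obtain ⟨k, hk⟩ := exists_of_rexp_ne_zero (h := fun _ => 1) (by simpa using hX)
      exact (hΦ _ hk).of_update Finset.Subset.rfl hlt

end Input

/-! ### Correlation of the matched arcs -/

namespace Input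

variable {A : Type*} {I : Input A} {incl : Bool} {p : ℝ}

theorem rexp_mono (hp : p ∈ Icc (0 : ℝ) 1) (r : Round A) {g g' : Pick A → ℝ}
    (h : ∀ k, g k ≤ g' k) : r.rexp p g ≤ r.rexp p g' := by
  have h0 := hp.1
  have h1 : 0 ≤ 1 - p := sub_nonneg.2 hp.2
  rcases r with a | ⟨a₁, a₂, ne⟩
  · exact h _
  · unfold Round.rexp
    dsimp only
    gcongr <;> exact h _

theorem rexp_const (r : Round A) (c : ℝ) : r.rexp p (fun _ => c) = c := by
  rcases r with a | ⟨a₁, a₂, ne⟩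
  · rfl
  · simp [Round.rexp]
    ring

theorem rexp_comm (r r' : Round A) (g : Pick A → Pick A → ℝ) :
    r.rexp p (fun k => r'.rexp p fun k' => g k k') =
      r'.rexp p fun k' => r.rexp p fun k => g k k' := by
  rcases r with a | ⟨a₁, a₂, ne⟩ <;> rcases r' with a' | ⟨a₁', a₂', ne'⟩ <;>
    simp only [Round.rexp, Fintype.sum_prod_type, Fin.sum_univ_two, Fintype.sum_bool]
  ring

open Classical in
theorem rexp_some {r : Round A} {a : A} (hr : r.SemiAssigns a) (j : Fin 2) (g : Pick A → ℝ) :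
    r.rexp p (fun k => g k * if k = some (a, j) then 1 else 0) = p / 4 * g (some (a, j)) := by
  rcases r with a' | ⟨a₁, a₂, ne⟩
  · exact hr.elim
  · have hj : j = 0 ∨ j = 1 := by fin_cases j <;> simp
    rcases hr with rfl | rfl <;> rcases hj with rfl | rfl <;>
      simp [Round.rexp, Fintype.sum_prod_type, Fin.sum_univ_two, ne, ne.symm] <;> ring

theorem pexp_mono (hp : p ∈ Icc (0 : ℝ) 1) {T : ℕ} {g g' : (ℕ → Pick A) → ℝ}
    (h : ∀ X, g X ≤ g' X) : I.pexp p T g ≤ I.pexp p T g' := by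
  induction T generalizing g g' with
  | zero => exact h _
  | succ T ih => exact ih fun X => rexp_mono hp _ fun k => h _

theorem pexp_const (T : ℕ) (c : ℝ) : I.pexp p T (fun _ => c) = c := by
  induction T with
  | zero => rfl
  | succ T ih => simp only [pexp, rexp_const, ih]

theorem pexp_const_mul (T : ℕ) (c : ℝ) (g : (ℕ → Pick A) → ℝ) :
    I.pexp p T (fun X => c * g X) = c * I.pexp p T g :=
  (I.isLinearMap_pexp p T).map_smul c g

theorem pexp_sub (T : ℕ) (g g' : (ℕ → Pick A) → ℝ) :
    I.pexp p T (fun X => g X - g' X) = I.pexp p T g - I.pexp p T g' :=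
  (I.isLinearMap_pexp p T).map_sub g g'

/-- The pick of one round may be drawn again. -/
theorem pexp_resample {s T : ℕ} (hs : s < T) (g : (ℕ → Pick A) → ℝ) :
    I.pexp p T g = I.pexp p T fun X => (I.round s).rexp p fun k => g (Function.update X s k) := by
  induction T generalizing g with
  | zero => exact absurd hs s.not_lt_zero
  | succ T ih =>
    rw [pexp, pexp]
    rcases Nat.lt_succ_iff_lt_or_eq.1 hs with hs | rfl
    · rw [ih hs]
      congr 1
      funext X
      rw [rexp_comm]
      simp only [Function.update_comm hs.ne]
    · simp only [Function.update_idem, rexp_const]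

open Classical in
theorem pexp_mul_none {n T : ℕ} (hn : n < T) {a : A} (ha : (I.round n).SemiAssigns a)
    {g : (ℕ → Pick A) → ℝ} (hg : ∀ X k, g (Function.update X n k) = g X) :
    I.pexp p T (fun X => g X * if X n = none then 1 else 0) = (1 - p) * I.pexp p T g := by
  rw [pexp_resample hn, ← pexp_const_mul]
  congr 1
  funext X
  simp only [hg, Function.update_self]
  exact rexp_none ha fun _ => g X

open Classical in
theorem pexp_mul_some {s T : ℕ} (hs : s < T) {a : A} (ha : (I.round s).SemiAssigns a)
    (j : Fin 2) (g : (ℕ → Pick A) → ℝ) :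
    I.pexp p T (fun X => g X * if X s = some (a, j) then 1 else 0) =
      p / 4 * I.pexp p T fun X => g (Function.update X s (some (a, j))) := by
  rw [pexp_resample hs, ← pexp_const_mul]
  congr 1
  funext X
  simp only [Function.update_self]
  exact rexp_some ha j fun k => g (Function.update X s k)

theorem weight_nonneg (S : Finset ℕ) (X : ℕ → Pick A) (t : ℕ) : 0 ≤ I.weight incl S X t := by
  unfold weight
  split_ifs <;> positivity

theorem weight_le_one (S : Finset ℕ) (X : ℕ → Pick A) (t : ℕ) : I.weight incl S X t ≤ 1 := by
  classical
  unfold weight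
  split_ifs
  · exact div_le_one_of_le₀ (by exact_mod_cast Finset.card_filter_le _ _) (Nat.cast_nonneg _)
  · exact le_rfl

/-- An impression outside `S` that picks an arc to `n` does not protect other impressions from being
matched inside `S`. -/
theorem weight_update_le {S : Finset ℕ} {X : ℕ → Pick A} {s t n : ℕ} {b : A} {k : Pick A}
    (hs : s ∉ S) (ht : t ∈ S) (htn : t ≠ n)
    (h : I.PicksArc incl (Function.update X s k) b s n) :
    I.weight incl S (Function.update X s k) t ≤ I.weight incl S X t := by
  classical
  have hts : t ≠ s := ne_of_mem_of_not_mem ht hs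
  -- The new pick of `s` goes to `n ≠ t`, so `s` just disappears from the in-arcs of `t`. The arcs
  -- from `S` (number `C`) stay, those from outside drop from `N` to `N'`, and `N / (N + C)` is
  -- increasing in `N` for fixed `C`.
  have hmem : ∀ e, e ∈ I.inArcs incl (Function.update X s k) t ↔
      e ∈ I.inArcs incl X t ∧ e.1 ≠ s := by
    intro e
    constructor
    · intro he
      have hes : e.1 ≠ s := by
        intro hes
        have he' := mem_inArcs.1 he
        rw [hes] at he'
        exact htn (h.unique he').2.symm
      exact ⟨mem_inArcs.2 ((PicksArc.congr (Function.update_of_ne hes _ _)).1 (mem_inArcs.1 he)),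
        hes⟩
    · rintro ⟨he, hes⟩
      exact mem_inArcs.2 ((PicksArc.congr (Function.update_of_ne hes _ _)).2 (mem_inArcs.1 he))
  have hC : (I.inArcs incl (Function.update X s k) t).filter (fun e => ¬ e.1 ∉ S) =
      (I.inArcs incl X t).filter fun e => ¬ e.1 ∉ S := by
    ext e
    rw [Finset.mem_filter, Finset.mem_filter, hmem, not_not]
    constructor
    · exact fun h => ⟨h.1.1, h.2⟩
    · exact fun h => ⟨⟨h.1, ne_of_mem_of_not_mem h.2 hs⟩, h.2⟩
  have hN : ((I.inArcs incl (Function.update X s k) t).filter fun e => e.1 ∉ S).card ≤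
      ((I.inArcs incl X t).filter fun e => e.1 ∉ S).card := by
    refine Finset.card_le_card fun e he => ?_
    rw [Finset.mem_filter, hmem] at he
    exact Finset.mem_filter.2 ⟨he.1.1, he.2⟩
  have h1 := Finset.card_filter_add_card_filter_not (s := I.inArcs incl X t) fun e => e.1 ∉ S
  have h2 := Finset.card_filter_add_card_filter_not
    (s := I.inArcs incl (Function.update X s k) t) fun e => e.1 ∉ S
  rw [hC] at h2
  rw [weight, weight, Function.update_of_ne hts]
  simp only [← Finset.card_pos]
  generalize ((I.inArcs incl X t).filter fun e => ¬ e.1 ∉ S).card = C at *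
  generalize ((I.inArcs incl (Function.update X s k) t).filter fun e => e.1 ∉ S).card = N' at *
  generalize ((I.inArcs incl X t).filter fun e => e.1 ∉ S).card = N at *
  rw [← h1, ← h2]
  have hNR : (N' : ℝ) ≤ N := by exact_mod_cast hN
  by_cases hX : X t = none
  · simp only [hX, true_and]
    split_ifs with h3 h4 h4
    · have h3' : (0 : ℝ) < ((N' + C : ℕ) : ℝ) := by exact_mod_cast h3
      have h4' : (0 : ℝ) < ((N + C : ℕ) : ℝ) := by exact_mod_cast h4
      rw [div_le_div_iff₀ h3' h4']
      push_cast
      nlinarith [mul_le_mul_of_nonneg_right hNR (Nat.cast_nonneg (α := ℝ) C)]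
    · omega
    · have hN0 : C = 0 := by omega
      have h4' : ((N + C : ℕ) : ℝ) ≠ 0 := by exact_mod_cast h4.ne'
      rw [hN0, add_zero] at h4' ⊢
      rw [div_self h4']
    · exact le_rfl
  · simp [hX]

/-! ### Competing arcs and the gain from one arc of `D` -/

open Classical in
/-- The in-arcs of `n` in `D` from impressions outside `S`. -/
def outerArcs (I : Input A) (incl : Bool) (S : Finset ℕ) (n : ℕ) : Finset (ℕ × A) :=
  (Finset.range n ×ˢ (I.round n).advs).filter fun e => I.Arc incl e.2 e.1 n ∧ e.1 ∉ S

theorem mem_outerArcs {S : Finset ℕ} {n : ℕ} {e : ℕ × A} :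
    e ∈ I.outerArcs incl S n ↔ I.Arc incl e.2 e.1 n ∧ e.1 ∉ S := by
  classical
  rw [outerArcs, Finset.mem_filter, Finset.mem_product, Finset.mem_range, Round.mem_advs]
  exact and_iff_right_of_imp fun h => ⟨h.1.lt, h.1.semiAssigns_right⟩

theorem card_advs_le (r : Round A) : r.advs.card ≤ 2 := by
  classical
  rcases r with a | ⟨a₁, a₂, ne⟩
  · simp [Round.advs]
  · exact Finset.card_le_two

/-- There are at most two in-arcs for each of the two advertisers, and the one from `m` is not
outer. -/
theorem card_outerArcs_le {S : Finset ℕ} {m n : ℕ} {a : A} (h : I.Arc incl a m n) (hm : m ∈ S) :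
    (I.outerArcs incl S n).card ≤ 3 := by
  classical
  have hsub : insert (m, a) (I.outerArcs incl S n) ⊆ (I.round n).advs.biUnion fun b =>
      ((Finset.range n).filter fun i => I.Arc incl b i n).image fun i => (i, b) := by
    have key : ∀ e : ℕ × A, I.Arc incl e.2 e.1 n → e ∈ (I.round n).advs.biUnion fun b =>
        ((Finset.range n).filter fun i => I.Arc incl b i n).image fun i => (i, b) := by
      intro e he
      exact Finset.mem_biUnion.2 ⟨e.2, Round.mem_advs.2 he.semiAssigns_right,
        Finset.mem_image.2 ⟨e.1, Finset.mem_filter.2 ⟨Finset.mem_range.2 he.lt, he⟩, rfl⟩⟩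
    intro e he
    rcases Finset.mem_insert.1 he with rfl | he
    · exact key _ h
    · exact key e (mem_outerArcs.1 he).1
  have h1 := (Finset.card_le_card hsub).trans (Finset.card_biUnion_le_card_mul _ _ 2 fun b _ =>
    Finset.card_image_le.trans (card_inArcs_le_two incl b n))
  rw [Finset.card_insert_of_notMem fun h' => (mem_outerArcs.1 h').2 hm] at h1
  have h2 := card_advs_le (I.round n)
  omega

open Classical in
/-- The number of picked in-arcs of `n` from impressions outside `S`. -/
def outerCount (I : Input A) (incl : Bool) (S : Finset ℕ) (n : ℕ) (X : ℕ → Pick A) : ℝ :=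
  ∑ e ∈ I.outerArcs incl S n, if I.PicksArc incl X e.2 e.1 n then 1 else 0

theorem outerCount_nonneg {S : Finset ℕ} {n : ℕ} {X : ℕ → Pick A} :
    0 ≤ I.outerCount incl S n X := by
  classical
  exact Finset.sum_nonneg fun e _ => by split_ifs <;> norm_num

theorem outerCount_update {S : Finset ℕ} {n s : ℕ} (hs : s ∈ S ∨ n ≤ s) (X : ℕ → Pick A)
    (k : Pick A) : I.outerCount incl S n (Function.update X s k) = I.outerCount incl S n X := by
  classical
  unfold outerCount
  refine Finset.sum_congr rfl fun e he => if_congr (PicksArc.congr ?_) rfl rfl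
  rw [Function.update_of_ne]
  rintro rfl
  obtain ⟨h1, h2⟩ := mem_outerArcs.1 he
  exact hs.elim h2 h1.lt.not_ge

theorem outerCount_eq_card {S : Finset ℕ} {n : ℕ} {X : ℕ → Pick A}
    [DecidablePred fun e : ℕ × A => e.1 ∉ S] :
    I.outerCount incl S n X = (((I.inArcs incl X n).filter fun e => e.1 ∉ S).card : ℝ) := by
  classical
  rw [outerCount, ← Finset.sum_filter, ← Finset.cast_card]
  congr 2
  ext e
  rw [Finset.mem_filter, Finset.mem_filter, mem_outerArcs, mem_inArcs]
  exact ⟨fun h => ⟨h.2, h.1.2⟩, fun h => ⟨⟨h.1.1, h.2⟩, h.1⟩⟩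

/-- With `C ≥ 1` picked arcs from `S` and `N` from outside, the chance of a match inside `S` is `C /
(N + C)`, smallest at `C = 1`. -/
theorem weight_le_of_picked {S : Finset ℕ} {m n : ℕ} {a : A} {X : ℕ → Pick A} (hm : m ∈ S)
    (hn : X n = none) (h : I.PicksArc incl X a m n) :
    1 / (1 + I.outerCount incl S n X) ≤ 1 - I.weight incl S X n := by
  classical
  have he := mem_inArcs (e := (m, a)).2 h
  rw [outerCount_eq_card, weight, if_pos ⟨hn, _, he⟩]
  have h1 := Finset.card_filter_add_card_filter_not (s := I.inArcs incl X n) fun e => e.1 ∉ S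
  have h2 : 0 < ((I.inArcs incl X n).filter fun e => ¬ e.1 ∉ S).card :=
    Finset.card_pos.2 ⟨_, Finset.mem_filter.2 ⟨he, not_not.2 hm⟩⟩
  rw [← h1]
  generalize ((I.inArcs incl X n).filter fun e => ¬ e.1 ∉ S).card = C at *
  generalize ((I.inArcs incl X n).filter fun e => e.1 ∉ S).card = N at *
  have hC : (1 : ℝ) ≤ C := by exact_mod_cast h2
  have hN : (0 : ℝ) ≤ N := Nat.cast_nonneg _
  push_cast
  rw [one_sub_div (by positivity), div_le_div_iff₀ (by positivity) (by positivity)]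
  nlinarith [mul_nonneg hN (sub_nonneg.2 hC)]

/-- Negative correlation: each outer arc is picked with probability `p / 4`, and by `hV` forcing
that pick does not increase `V`. -/
theorem pexp_mul_outerCount_le (hp : p ∈ Icc (0 : ℝ) 1) {S : Finset ℕ} {m n T : ℕ} {a : A}
    (hnT : n < T) (harc : I.Arc incl a m n) (hm : m ∈ S) {V : (ℕ → Pick A) → ℝ}
    (hV0 : ∀ X, 0 ≤ V X)
    (hV : ∀ X s k b, s ∉ S → I.PicksArc incl (Function.update X s k) b s n →
      V (Function.update X s k) ≤ V X) :
    I.pexp p T (fun X => V X * I.outerCount incl S n X) ≤ 3 * (p / 4) * I.pexp p T V := by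
  classical
  have hp4 : 0 ≤ p / 4 := by linarith [hp.1]
  have hE : 0 ≤ I.pexp p T V := by
    rw [← I.pexp_const (p := p) T 0]
    exact pexp_mono hp hV0
  have key : ∀ e ∈ I.outerArcs incl S n,
      I.pexp p T (fun X => V X * if I.PicksArc incl X e.2 e.1 n then 1 else 0) ≤
        p / 4 * I.pexp p T V := by
    intro e he
    obtain ⟨h1, h2⟩ := mem_outerArcs.1 he
    have hiff : ∀ X : ℕ → Pick A, I.PicksArc incl X e.2 e.1 n ↔
        X e.1 = some (e.2, (⟨_, h1.arcIndex_lt_two⟩ : Fin 2)) := by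
      intro X
      constructor
      · rintro ⟨-, j, hj, hj'⟩
        rw [hj]
        congr 2
        exact Fin.ext hj'
      · exact fun h => ⟨h1, _, h, rfl⟩
    simp only [hiff]
    rw [pexp_mul_some (h1.lt.trans hnT) h1.semiAssigns_left]
    refine mul_le_mul_of_nonneg_left (pexp_mono hp fun X => hV X _ _ e.2 h2 ?_) hp4
    rw [hiff, Function.update_self]
  simp only [outerCount, Finset.mul_sum]
  rw [pexp_sum]
  refine (Finset.sum_le_card_nsmul _ _ _ key).trans ?_
  rw [nsmul_eq_mul, ← mul_assoc]
  refine mul_le_mul_of_nonneg_right (mul_le_mul_of_nonneg_right ?_ hp4) hE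
  exact_mod_cast card_outerArcs_le harc hm

/-- The mass lost through the weight of `n` is bounded below on the event that `m` picks its arc to
`n` and `n` is a receiver. -/
theorem pexp_mul_weight_le (hp : p ∈ Icc (0 : ℝ) 1) {S : Finset ℕ} {m n T : ℕ} {a : A}
    (hnT : n < T) (harc : I.Arc incl a m n) (hm : m ∈ S) {V : (ℕ → Pick A) → ℝ}
    (hV0 : ∀ X, 0 ≤ V X) (hVm : ∀ X k, V (Function.update X m k) = V X)
    (hVn : ∀ X k, V (Function.update X n k) = V X)
    (hV : ∀ X s k b, s ∉ S → I.PicksArc incl (Function.update X s k) b s n →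
      V (Function.update X s k) ≤ V X) :
    I.pexp p T (fun X => I.weight incl S X n * (I.weight incl S X m * V X)) ≤
      (1 - gam p) * I.pexp p T fun X => I.weight incl S X m * V X := by
  classical
  have h0 := hp.1
  have h1 : 0 ≤ 1 - p := sub_nonneg.2 hp.2
  set j : Fin 2 := ⟨_, harc.arcIndex_lt_two⟩ with hj
  set N := I.outerCount incl S n with hN
  have hN0 : ∀ X, 0 ≤ N X := fun X => outerCount_nonneg
  have hmatched : (1 - p) * (p / 4 * I.pexp p T fun X => V X * (1 / (1 + N X))) ≤
      I.pexp p T fun X =>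
        I.weight incl S X m * V X - I.weight incl S X n * (I.weight incl S X m * V X) := by
    -- Neither `V` nor `N` depends on the pick of `m`, so that pick contributes an independent
    -- factor `p / 4`.
    have e1 : (I.pexp p T fun X => V X * (1 / (1 + N X))) = I.pexp p T fun X =>
        V (Function.update X m (some (a, j))) *
          (1 / (1 + N (Function.update X m (some (a, j))))) := by
      simp only [hVm, hN, outerCount_update (Or.inl hm)]
    rw [e1, ← pexp_mul_some (harc.lt.trans hnT) harc.semiAssigns_left j fun X =>
      V X * (1 / (1 + N X)), ← pexp_mul_none hnT harc.semiAssigns_right]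
    · refine pexp_mono hp fun X => ?_
      have hw := weight_le_one (I := I) (incl := incl) S X n
      have hwm := weight_nonneg (I := I) (incl := incl) S X m
      have hrest : 0 ≤ I.weight incl S X m * V X -
          I.weight incl S X n * (I.weight incl S X m * V X) := by
        have := mul_nonneg (mul_nonneg hwm (hV0 X)) (sub_nonneg.2 hw)
        linarith
      by_cases hXm : X m = some (a, j)
      · by_cases hXn : X n = none
        · have hle := weight_le_of_picked hm hXn (I := I) (incl := incl) ⟨harc, j, hXm, rfl⟩
          have hwm1 : I.weight incl S X m = 1 := by
            rw [weight, if_neg (by simp [hXm])]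
          rw [if_pos hXm, if_pos hXn, hwm1]
          have := mul_le_mul_of_nonneg_left hle (hV0 X)
          linarith
        · rwa [if_neg hXn, mul_zero]
      · rwa [if_neg hXm, mul_zero, zero_mul]
    · intro X k
      rw [hVn, hN, outerCount_update (Or.inr le_rfl), Function.update_of_ne harc.lt.ne]
  have hinv : (1 - 3 * p / 8) * I.pexp p T V ≤ I.pexp p T fun X => V X * (1 / (1 + N X)) := by
    have h2 : I.pexp p T (fun X => V X - 1 / 2 * (V X * N X)) ≤
        I.pexp p T fun X => V X * (1 / (1 + N X)) := by
      refine pexp_mono hp fun X => ?_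
      have h3 : 1 - N X / 2 ≤ 1 / (1 + N X) := by
        rw [le_div_iff₀ (by linarith [hN0 X])]
        -- Integrality is needed: the inequality fails for `N` strictly between 0 and 1.
        have hint : N X = 0 ∨ 1 ≤ N X := by
          rw [hN, outerCount_eq_card]
          rcases Nat.eq_zero_or_pos
            ((I.inArcs incl X n).filter fun e => e.1 ∉ S).card with h | h
          · exact Or.inl (by rw [h, Nat.cast_zero])
          · exact Or.inr (by exact_mod_cast h)
        rcases hint with h | h
        · rw [h]; norm_num
        · nlinarith [mul_nonneg (hN0 X) (sub_nonneg.2 h)]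
      have := mul_le_mul_of_nonneg_left h3 (hV0 X)
      linarith
    rw [pexp_sub, pexp_const_mul] at h2
    have h3 := pexp_mul_outerCount_le hp hnT harc hm hV0 hV
    rw [← hN] at h3
    linarith
  have hle : (I.pexp p T fun X => I.weight incl S X m * V X) ≤ I.pexp p T V :=
    pexp_mono hp fun X => mul_le_of_le_one_left (hV0 X) (weight_le_one S X m)
  rw [pexp_sub] at hmatched
  have hc : 0 ≤ (1 - p) * (p / 4) := by positivity
  have h38 : 0 ≤ 1 - 3 * p / 8 := by linarith
  have h4 := mul_le_mul_of_nonneg_left ((mul_le_mul_of_nonneg_left hle h38).trans hinv) hc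
  have h5 : gam p = (1 - p) * (p / 4) * (1 - 3 * p / 8) := by unfold gam; ring
  rw [h5]
  linarith

theorem gam_nonneg (hp : p ∈ Icc (0 : ℝ) 1) : 0 ≤ gam p := by
  have h0 := hp.1
  have h1 : 0 ≤ 1 - p := sub_nonneg.2 hp.2
  have h2 : 0 ≤ 1 - 3 * p / 8 := by linarith
  unfold gam
  positivity

theorem gam_le_one (hp : p ∈ Icc (0 : ℝ) 1) : gam p ≤ 1 := by
  have h0 := hp.1
  have h1 : 0 ≤ 1 - p := sub_nonneg.2 hp.2
  have h2 : p * (1 - p) ≤ 1 := by nlinarith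
  have h3 : p * (1 - p) * (1 - 3 * p / 8) ≤ 1 :=
    mul_le_one₀ h2 (by linarith [hp.2]) (by linarith)
  unfold gam
  linarith

/-- The probability that no impression of `L` is matched with an earlier one of `S`, where
consecutive impressions in `L` are joined by arcs of `D`. -/
theorem pexp_prod_weight_le (hp : p ∈ Icc (0 : ℝ) 1) {S : Finset ℕ} {T : ℕ} {a : A}
    {L : Finset ℕ} (hLS : L ⊆ S) (hLT : ∀ n ∈ L, n < T)
    (harc : ∀ m ∈ L, ∀ n ∈ L, m < n → (∀ j ∈ L, m < j → n ≤ j) → I.Arc incl a m n) :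
    I.pexp p T (fun X => ∏ t ∈ L, I.weight incl S X t) ≤ (1 - gam p) ^ (L.card - 1) := by
  classical
  have hγ : 0 ≤ 1 - gam p := sub_nonneg.2 (gam_le_one hp)
  induction L using Finset.induction_on_max with
  | empty => simp [pexp_const]
  | insert n L hmax ih =>
    have hn : n ∉ L := fun h => (hmax n h).false
    rw [Finset.card_insert_of_notMem hn, Nat.add_sub_cancel]
    -- The first impression of `L` has no predecessor in `L` and yields no factor, whence the
    -- exponent `L.card - 1`.
    rcases L.eq_empty_or_nonempty with rfl | hne
    · rw [← I.pexp_const (p := p) T ((1 - gam p) ^ (∅ : Finset ℕ).card)]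
      refine pexp_mono hp fun X => ?_
      simpa using weight_le_one S X n
    have hLS' := (Finset.subset_insert _ _).trans hLS
    have ih := ih hLS' (fun t ht => hLT t (Finset.mem_insert_of_mem ht)) (by
      intro m hm k hk hmk hj
      refine harc m (Finset.mem_insert_of_mem hm) k (Finset.mem_insert_of_mem hk) hmk ?_
      intro j hjL hmj
      rcases Finset.mem_insert.1 hjL with rfl | hjL
      · exact (hmax k hk).le
      · exact hj j hjL hmj)
    set m := L.max' hne with hm
    have hmL : m ∈ L := L.max'_mem hne
    have hlt : ∀ t ∈ L.erase m, t < m := fun t ht => L.lt_max'_of_mem_erase_max' hne ht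
    have hA : I.Arc incl a m n := by
      refine harc m (Finset.mem_insert_of_mem hmL) n (Finset.mem_insert_self _ _)
        (hmax m hmL) ?_
      intro j hjL hmj
      rcases Finset.mem_insert.1 hjL with rfl | hjL
      · exact le_rfl
      · exact absurd (L.le_max' j hjL) hmj.not_ge
    have hnT := hLT n (Finset.mem_insert_self _ _)
    -- The weights before `m` are determined by the picks before `m`.
    have hstable : ∀ X s k, m ≤ s → ∏ t ∈ L.erase m, I.weight incl S (Function.update X s k) t =
        ∏ t ∈ L.erase m, I.weight incl S X t := fun X s k hs => Finset.prod_congr rfl fun t ht =>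
      weight_congr (fun r hr => Function.update_of_ne
        ((hr.trans_lt (hlt t ht)).trans_le hs).ne _ _) fun _ _ => Iff.rfl
    have key := pexp_mul_weight_le hp hnT hA (hLS' hmL)
      (V := fun X => ∏ t ∈ L.erase m, I.weight incl S X t)
      (fun X => Finset.prod_nonneg fun t _ => weight_nonneg S X t)
      (fun X k => hstable X m k le_rfl) (fun X k => hstable X n k hA.lt.le)
      (fun X s k b hs hb => Finset.prod_le_prod (fun t _ => weight_nonneg S _ t) fun t ht =>
        weight_update_le hs (hLS' (Finset.mem_of_mem_erase ht))
          ((hlt t ht).trans hA.lt).ne hb)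
    have hprod : ∀ X, I.weight incl S X m * ∏ t ∈ L.erase m, I.weight incl S X t =
        ∏ t ∈ L, I.weight incl S X t := fun X => Finset.mul_prod_erase L _ hmL
    simp only [hprod] at key
    simp only [Finset.prod_insert hn]
    refine key.trans ((mul_le_mul_of_nonneg_left ih hγ).trans_eq ?_)
    rw [← pow_succ', Nat.sub_add_cancel hne.card_pos]

end Input

/-! ### The guarantee -/

theorem Round.other_ne {A : Type*} {r : Round A} {a : A} (h : r.SemiAssigns a) :
    r.other a ≠ a := by
  rcases r with a' | ⟨a₁, a₂, ne⟩
  · exact h.elim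
  · rcases h with rfl | rfl <;> simp [other, ne, ne.symm]

theorem Round.other_eq {A : Type*} {r : Round A} {a b : A} (ha : r.SemiAssigns a)
    (hb : r.SemiAssigns b) (hab : a ≠ b) : r.other a = b := by
  rcases r with a' | ⟨a₁, a₂, ne⟩
  · exact ha.elim
  · rcases ha with rfl | rfl <;> rcases hb with rfl | rfl <;> simp_all [other]

theorem Round.semiAssigns_other {A : Type*} {r : Round A} {a : A} (h : r.SemiAssigns a) :
    r.SemiAssigns (r.other a) := by
  rcases r with a' | ⟨a₁, a₂, ne⟩
  · exact h.elim
  · rcases h with rfl | rfl <;> simp [other, ne.symm, SemiAssigns]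

theorem Round.DetAssigns.not_semiAssigns {A : Type*} {r : Round A} {a b : A}
    (h : r.DetAssigns a) : ¬ r.SemiAssigns b := by
  rcases r with a' | ⟨a₁, a₂, ne⟩
  · exact id
  · exact h.elim

theorem Round.DetAssigns.eq {A : Type*} {r : Round A} {a b : A}
    (ha : r.DetAssigns a) (hb : r.DetAssigns b) : a = b := by
  rcases r with a' | ⟨a₁, a₂, ne⟩
  · exact ha.trans hb.symm
  · exact ha.elim

namespace Input

variable {A : Type*} (I : Input A) (incl : Bool) {p : ℝ} {T : ℕ} {a : A} {y : ℝ}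

open Classical in
/-- The impressions among the first `T` that are semi-assigned to `a` and a subset containing `y`. -/
def path (T : ℕ) (a : A) (y : ℝ) : Finset ℕ :=
  (Finset.range T).filter fun t => I.SemiAssigned a y t

open Classical in
/-- The impressions of the path of `y` before the first one with a small bid. -/
def largePath (T : ℕ) (a : A) (y : ℝ) : Finset ℕ :=
  (Finset.range T).filter fun t => I.SemiAssigned a y t ∧ I.Large incl a t ∧
    ∀ s < t, I.SemiAssigned a y s → I.Large incl a s

variable {I incl}

theorem mem_path {t : ℕ} : t ∈ I.path T a y ↔ t < T ∧ I.SemiAssigned a y t := by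
  classical
  rw [path, Finset.mem_filter, Finset.mem_range]

theorem mem_largePath {t : ℕ} : t ∈ I.largePath incl T a y ↔
    t < T ∧ I.SemiAssigned a y t ∧ I.Large incl a t ∧
      ∀ s < t, I.SemiAssigned a y s → I.Large incl a s := by
  classical
  rw [largePath, Finset.mem_filter, Finset.mem_range]

theorem largePath_subset : I.largePath incl T a y ⊆ I.path T a y := fun _ ht =>
  mem_path.2 ⟨(mem_largePath.1 ht).1, (mem_largePath.1 ht).2.1⟩

theorem semiCount_eq_card (h : ¬ ∃ t < T, I.DetAssigned a y t) :
    I.semiCount T a y = ((I.path T a y).card : ℕ∞) := by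
  rw [semiCount, if_neg h, path]

theorem largeCount_eq_semiCount (h : ∀ t < T, I.SemiAssigned a y t → I.Large incl a t) :
    I.largeCount incl T a y = I.semiCount T a y := by
  rw [largeCount, if_neg]
  rintro ⟨t, ht, h1, h2⟩
  exact h2 (h t ht h1)

theorem largeCount_eq_card (h : ¬ ∃ t < T, I.DetAssigned a y t) :
    I.largeCount incl T a y = ((I.largePath incl T a y).card : ℕ∞) := by
  by_cases hs : ∃ t < T, I.SemiAssigned a y t ∧ ¬ I.Large incl a t
  · rw [largeCount, if_pos hs, largePath]
  · push Not at hs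
    rw [largeCount_eq_semiCount hs, semiCount_eq_card h]
    congr 2
    refine Finset.Subset.antisymm (fun t ht => ?_) largePath_subset
    obtain ⟨h1, h2⟩ := mem_path.1 ht
    exact mem_largePath.2 ⟨h1, h2, hs t h1 h2, fun s hst => hs s (hst.trans h1)⟩

/-- Anything on the path before `n` is large and so belongs to the large path; hence consecutive
members are adjacent at the point `y` itself. -/
theorem arc_of_mem_largePath {m n : ℕ} (hm : m ∈ I.largePath incl T a y)
    (hn : n ∈ I.largePath incl T a y) (hmn : m < n)
    (hnext : ∀ j ∈ I.largePath incl T a y, m < j → n ≤ j) : I.Arc incl a m n := by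
  obtain ⟨-, hm1, hmL, -⟩ := mem_largePath.1 hm
  obtain ⟨hnT, hn1, hnL, hn2⟩ := mem_largePath.1 hn
  refine ⟨⟨hmn, y, hm1, hn1, fun j hmj hjn hj => ?_⟩, hmL, hnL⟩
  refine (hnext j (mem_largePath.2 ⟨hjn.trans hnT, hj, hn2 j hjn hj, fun s hsj => ?_⟩)
    hmj).not_gt hjn
  exact hn2 s (hsj.trans hjn)

/-- If the arc is labelled `a`, exactly one end selects `a`. If not, its label is the other
advertiser of both ends, and again they cannot both select it. -/
theorem conflicting_path (X : ℕ → Pick A) :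
    I.Conflicting incl (I.path T a y) (fun t => (I.round t).other a) X := by
  intro t ht _ e he hes
  have harc := (mem_inArcs.1 he).1
  have hta := (mem_path.1 ht).2.1
  have hsa := (mem_path.1 hes).2.1
  unfold required
  dsimp only
  split_ifs with h
  · have hab : a ≠ e.2 := by
      rw [← h]
      exact (Round.other_ne hta).symm
    rw [Round.other_eq hsa harc.semiAssigns_left hab,
      Round.other_eq harc.semiAssigns_left hsa hab.symm]
    exact hab.symm
  · have hab : a = e.2 := by
      by_contra hab
      exact h (Round.other_eq hta harc.semiAssigns_right hab)
    rw [← hab]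
    exact Round.other_ne hsa

theorem lexp_sel_path_le (hp : p ∈ Icc (0 : ℝ) 1) :
    I.lexp incl p T (fun H => H.sel (I.path T a y) fun t => (I.round t).other a) ≤
      (1 / 2) ^ (I.path T a y).card * (1 - gam p) ^ ((I.largePath incl T a y).card - 1) := by
  classical
  have key := lexp_picks_mul_sel (I := I) (incl := incl) (p := p) (T := T)
    (S := I.path T a y) (σ := fun t => (I.round t).other a) (Φ := fun _ => 1)
    (fun t ht => ⟨(mem_path.1 ht).1, Round.semiAssigns_other (mem_path.1 ht).2.1⟩)
    fun X _ => conflicting_path X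
  simp only [one_mul] at key
  rw [key]
  simp only [weights]
  rw [pexp_const_mul]
  refine mul_le_mul_of_nonneg_left ?_ (by positivity)
  -- Weights after the large run are bounded by 1; those kept still refer to matches within the
  -- whole path.
  refine le_trans (pexp_mono hp fun X => ?_) (pexp_prod_weight_le hp
    (largePath_subset (I := I) (incl := incl) (T := T) (a := a) (y := y))
    (fun n hn => (mem_largePath.1 hn).1) fun m hm n hn => arc_of_mem_largePath hm hn)
  rw [← Finset.prod_sdiff (largePath_subset (I := I) (incl := incl))]
  exact mul_le_of_le_one_left (Finset.prod_nonneg fun t _ => weight_nonneg _ X t)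
    (Finset.prod_le_one (fun t _ => weight_nonneg _ X t) fun t _ => weight_le_one _ X t)

theorem assignProb_eq_one (hp : p ∈ Icc (0 : ℝ) 1) (h : ∃ t < T, I.DetAssigned a y t) :
    I.assignProb incl p hp T a y = 1 := by
  classical
  rw [assignProb_eq]
  refine Eq.trans (I.lexp_congr fun H hH => ?_) (I.lexp_const (incl := incl) (p := p) T 1)
  obtain ⟨t, ht, hd, hy⟩ := h
  obtain ⟨d, hd', hinv⟩ := hH t ht
  rw [if_pos]
  refine ⟨t, ht, ⟨d, hd', ?_⟩, hy⟩
  exact hinv.elim (fun h => h.eq hd) fun h => absurd h hd.not_semiAssigns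

theorem assignProb_eq_one_sub (hp : p ∈ Icc (0 : ℝ) 1) (h : ¬ ∃ t < T, I.DetAssigned a y t) :
    I.assignProb incl p hp T a y =
      1 - I.lexp incl p T fun H => H.sel (I.path T a y) fun t => (I.round t).other a := by
  classical
  have hsub : ∀ f g : History A → ℝ, I.lexp incl p T (fun H => f H - g H) =
      I.lexp incl p T f - I.lexp incl p T g := (I.isLinearMap_lexp incl p T).map_sub
  rw [assignProb_eq]
  refine Eq.trans (I.lexp_congr (g' := fun H => 1 - H.sel _ _) fun H hH => ?_)
    ((hsub _ _).trans (congrArg (· - _) (I.lexp_const T 1)))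
  have hiff : (∃ t < T, H.Selected t a ∧ y ∈ I.subset a t) ↔
      ¬ ∀ t ∈ I.path T a y, H.Selected t ((I.round t).other a) := by
    push Not
    constructor
    · rintro ⟨t, ht, hsel, hy⟩
      obtain ⟨d, hd, hinv⟩ := hH t ht
      rw [History.Selected.unique ⟨d, hd, rfl⟩ hsel] at hinv
      have hs : (I.round t).SemiAssigns a := hinv.resolve_left fun hda => h ⟨t, ht, hda, hy⟩
      exact ⟨t, mem_path.2 ⟨ht, hs, hy⟩, fun ho => (hH.selected_other ht hs).1 ho hsel⟩
    · rintro ⟨t, ht, ho⟩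
      obtain ⟨hT, hs, hy⟩ := mem_path.1 ht
      rw [hH.selected_other hT hs, not_not] at ho
      exact ⟨t, hT, ho, hy⟩
  rw [if_congr hiff rfl rfl, History.sel]
  split_ifs <;> simp_all

theorem guarantee_le_assignProb (hp : p ∈ Icc (0 : ℝ) 1) :
    guarantee (gam p) (I.semiCount T a y) (I.largeCount incl T a y) ≤
      I.assignProb incl p hp T a y := by
  by_cases h : ∃ t < T, I.DetAssigned a y t
  · rw [assignProb_eq_one hp h, guarantee, if_pos]
    rw [semiCount, if_pos h]
  · rw [assignProb_eq_one_sub hp h, semiCount_eq_card h, largeCount_eq_card h, guarantee,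
      if_neg (ENat.natCast_ne_top _), ENat.toNat_natCast, ENat.toNat_natCast]
    exact sub_le_sub_left (lexp_sel_path_le hp) 1

end Input

end PanOCS

end

theorem mainTheorem5 {A : Type*} (I : PanOCS.Input A) (incl : Bool)
    (p : ℝ) (hp : p ∈ Set.Icc (0 : ℝ) 1) (T : ℕ) :
    (∀ (a : A) (y : ℝ), y ∈ Set.Ico 0 (I.budget a) →
      PanOCS.guarantee (PanOCS.gam p) (I.semiCount T a y) (I.largeCount incl T a y) ≤
        I.assignProb incl p hp T a y) ∧
    ((∀ (a : A) (i : ℕ), i < T → I.bid a i ≠ 0 → I.Large incl a i) →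
      (0 ≤ PanOCS.gam p ∧ PanOCS.gam p ≤ 1) ∧
      ∀ (a : A) (y : ℝ), y ∈ Set.Ico 0 (I.budget a) →
        PanOCS.guarantee (PanOCS.gam p) (I.semiCount T a y) (I.semiCount T a y) ≤
          I.assignProb incl p hp T a y) := by
  refine ⟨fun a y _ => PanOCS.Input.guarantee_le_assignProb hp, fun hL =>
    ⟨⟨PanOCS.Input.gam_nonneg hp, PanOCS.Input.gam_le_one hp⟩, fun a y _ => ?_⟩⟩
  have h := PanOCS.Input.guarantee_le_assignProb (I := I) (incl := incl) (T := T) (a := a)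
    (y := y) hp
  rwa [PanOCS.Input.largeCount_eq_semiCount] at h
  intro t ht hs
  -- A zero bid receives the empty subset, so it never lies on the path of `y`.
  refine hL a t ht fun h0 => ?_
  have hy := hs.2
  rw [I.subset_eq_empty h0] at hy
  exact hy
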